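/- **Setting.** Let $g:[0,1]^s\to\mathbb R$ be measurable and suppose that $X=g(\mathbf U)$, with $\mathbf U$ uniform on $[0,1]^s$, has a density $f$ over $\mathbb R$. Let $a<b$ be real. Let the kernel $k:\mathbb R\to[0,\infty)$ be a probability density that is symmetric about $0$, nondecreasing on $(-\infty,0]$ and nonincreasing on $[0,\infty)$, with $0<\int x^2k(x)\,dx<\infty$, and put $\mu_0(k^2)=\int_{\mathbb R}k(x)^2\,dx$. For random points $\mathbf U_1,\dots,\mathbf U_n$ of $[0,1]^s$ and a bandwidth $h>0$, the kernel density estimator is $$\hat f_n(x)=\frac1{nh}\sum_{i=1}^n k\Big(\frac{x-g(\mathbf U_i)}h\Big),$$ and $$\mathrm{IV}=\int_a^b\mathbb E\big(\hat f_n(x)-\mathbb E\hat f_n(x)\big)^2dx,\qquad \mathrm{MISE}=\int_a^b\mathbb E\big(\hat f_n(x)-f(x)\big)^2dx .$$ A $(t,m,s)$-net in base $2$, with $0\le t\le m$, is a family of $2^m$ points of $[0,1)^s$ such that every box $\prod_{j=1}^s[c_j2^{-d_j},(c_j+1)2^{-d_j})$ with integers $d_j\ge 0$, $0\le c_j<2^{d_j}$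 and $\sum_j d_j=m-t$ contains exactly $2^t$ of them. Nested uniform scrambling (NUS) takes, for each coordinate $j$ and each finite binary string $w$, an independent uniformly random permutation $\pi_{j,w}$ of $\{0,1\}$, and replaces the $j$-th coordinate $0.a_1a_2a_3\dots$ (canonical binary expansion) of every point by $0.x_1x_2x_3\dots$ with $x_\ell=\pi_{j,a_1\cdots a_{\ell-1}}(a_\ell)$; the same permutations are used for all points. **Proposition 4.4.** Fix $s,g,f,k,a,b$ as above and an integer $T\ge0$. Let $\mathbf U_1,\dots,\mathbf U_n$, $n=2^m$, be a $(t,m,s)$-net in base $2$ with $t\le T$, randomized by NUS. All constants below are independent of $t\le T$, of $m$, and of the net. 1. There is a constant $C$ such that, for all such nets and all $h\in(0,1]$, $$\mathrm{IV}\le \frac{2^t3^s\mu_0(k^2)}{nh}+C\,\frac hn .$$ 2. There is a constant $K$ such that, for all such nets and all $h\in(0,1]$, $\mathrm{IV}\le K/(nh)$. 3. Suppose in addition that $f$, as a function on $\mathbb R$, is four times differentiable at every point of $[a,b]$ (in the two-sided sense also at $a$ and at $b$), and that $\int_a^b (f^{(r)}(x))^2dx<\infty$ for $r=0,\dots,4$.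 Then: - for every positive sequence $h=h(n)=\Theta(n^{-1/5})$ there is a constant $K'$ such that $\mathrm{MISE}\le K'n^{-4/5}$ for all such nets with bandwidth $h(n)$; - for every such net and every $h>0$, $\mathrm{MISE}\le 2^t3^s\,\mathrm{MISE}_{\mathrm{MC}}$, where $\mathrm{MISE}_{\mathrm{MC}}$ is the MISE for the same $n$ and $h$ when the $n$ points are independent and uniform on $[0,1]^s$. That is, the MISE never converges at a worse rate than with plain Monte Carlo. -/

import Mathlib

open MeasureTheory ProbabilityTheory Filter Topology Asymptotics

/-- `(t,m,s)`-nets in base `2`: a family (points may be repeated) of `2^m` points of `[0,1)^s` such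
that every elementary dyadic box `∏ j, [c j / 2^(d j), (c j + 1) / 2^(d j))` of volume `2^(t-m)`
contains exactly `2^t` of them. -/
structure IsTMSNet (t m : ℕ) {s : ℕ} (P : Fin (2 ^ m) → Fin s → ℝ) : Prop where
  t_le : t ≤ m
  mem : ∀ i j, 0 ≤ P i j ∧ P i j < 1
  count : ∀ d : Fin s → ℕ, ∑ j, d j = m - t → ∀ c : Fin s → ℕ, (∀ j, c j < 2 ^ d j) →
    Nat.card {i : Fin (2 ^ m) // ∀ j, (c j : ℝ) / 2 ^ d j ≤ P i j ∧
      P i j < ((c j : ℝ) + 1) / 2 ^ d j} = 2 ^ t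

/-- Nested scramble of a sequence of binary digits: the digit at position `l` is permuted by the
permutation attached to the string of the `l` digits that precede it. -/
def scrambleDigits (p : List (Fin 2) → Equiv.Perm (Fin 2)) (d : ℕ → Fin 2) : ℕ → Fin 2 :=
  fun l => p ((List.range l).map d) (d l)

/-- Nested scramble of a point of `[0,1)^s`, coordinate by coordinate, in base `2`. -/
noncomputable def scramblePoint {s : ℕ} (p : Fin s → List (Fin 2) → Equiv.Perm (Fin 2))
    (x : Fin s → ℝ) : Fin s → ℝ :=
  fun j => Real.ofDigits (scrambleDigits (p j) (Real.digits (x j) 2))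

/-- The random permutations of nested uniform scrambling in base `2`: one for each coordinate and
each finite string of digits, each uniform on the permutations of `{0,1}`, all independent. -/
structure IsUniformScrambling {Ω : Type*} [MeasurableSpace Ω] (μ : Measure Ω) {s : ℕ}
    (π : Ω → Fin s → List (Fin 2) → Equiv.Perm (Fin 2)) : Prop where
  meas : ∀ j w σ, MeasurableSet {ω | π ω j w = σ}
  unif : ∀ j w σ, μ {ω | π ω j w = σ} = 1 / 2
  indep : iIndepFun (m := fun _ : Fin s × List (Fin 2) => (⊤ : MeasurableSpace (Equiv.Perm (Fin 2))))
    (fun q ω => π ω q.1 q.2) μ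

/-- `U` is a `(t,m,s)`-net in base `2` randomized by nested uniform scrambling: the same random
permutations are applied to all the points of a deterministic net. -/
def IsScrambledNet {Ω : Type*} [MeasurableSpace Ω] (μ : Measure Ω) (t m : ℕ) {s : ℕ}
    (U : Ω → Fin (2 ^ m) → Fin s → ℝ) : Prop :=
  ∃ P : Fin (2 ^ m) → Fin s → ℝ, IsTMSNet t m P ∧
    ∃ π : Ω → Fin s → List (Fin 2) → Equiv.Perm (Fin 2), IsUniformScrambling μ π ∧
      ∀ ω i, U ω i = scramblePoint (π ω) (P i)

/-- The uniform distribution on `[0,1]^s`. -/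
noncomputable def uniformCube (s : ℕ) : Measure (Fin s → ℝ) :=
  volume.restrict (Set.univ.pi fun _ => Set.Icc (0 : ℝ) 1)

/-- `U` is a crude Monte Carlo sample: independent points, each uniform on `[0,1]^s`. -/
structure IsMonteCarlo {Ω : Type*} [MeasurableSpace Ω] (μ : Measure Ω) {n s : ℕ}
    (U : Ω → Fin n → Fin s → ℝ) : Prop where
  meas : ∀ i, Measurable fun ω => U ω i
  unif : ∀ i, μ.map (fun ω => U ω i) = uniformCube s
  indep : iIndepFun (fun i ω => U ω i) μ

/-- Standing assumption on the kernel: a probability density, symmetric about `0`, nondecreasing on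
`(-∞,0]` and nonincreasing on `[0,∞)`, with positive and finite second moment. -/
structure IsKernel (k : ℝ → ℝ) : Prop where
  nonneg : ∀ x, 0 ≤ k x
  integrable : Integrable k
  integral_eq_one : ∫ x, k x = 1
  symm : ∀ x, k (-x) = k x
  mono : MonotoneOn k (Set.Iic 0)
  anti : AntitoneOn k (Set.Ici 0)
  integrable_sq_mul : Integrable fun x => x ^ 2 * k x
  second_moment_pos : 0 < ∫ x, x ^ 2 * k x

/-- `f` is a probability density, over `ℝ`, of `g(U)` for `U` uniform on `[0,1]^s`. -/
structure IsDensityOf {s : ℕ} (f : ℝ → ℝ) (g : (Fin s → ℝ) → ℝ) : Prop where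
  meas : Measurable f
  nonneg : ∀ x, 0 ≤ f x
  law : (uniformCube s).map g = volume.withDensity fun x => ENNReal.ofReal (f x)

/-- `f` is `r` times differentiable at `x`: for `r + 1`, this means that `f` is `r` times
differentiable around `x` and that its `r`-th derivative is differentiable at `x`. -/
def TimesDifferentiableAt (f : ℝ → ℝ) : ℕ → ℝ → Prop
  | 0, _ => True
  | r + 1, x => (∀ᶠ y in 𝓝 x, TimesDifferentiableAt f r y) ∧
      DifferentiableAt ℝ (iteratedDeriv r f) x

/-- Standing assumption on the density: four times differentiable at every point of `[a,b]`,
including the end points, and the squares of the derivatives of orders `0` to `4` are integrable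
over `[a,b]`. -/
structure IsSmoothDensityOn (f : ℝ → ℝ) (a b : ℝ) : Prop where
  diff : ∀ x ∈ Set.Icc a b, TimesDifferentiableAt f 4 x
  roughness : ∀ r ≤ 4, IntegrableOn (fun x => (iteratedDeriv r f x) ^ 2) (Set.Icc a b)

/-- The kernel density estimator with kernel `k` and bandwidth `h` for the sample `X`. -/
noncomputable def kde (k : ℝ → ℝ) (h : ℝ) {n : ℕ} (X : Fin n → ℝ) (x : ℝ) : ℝ :=
  1 / ((n : ℝ) * h) * ∑ i, k ((x - X i) / h)

/-- The integrated variance over `[a,b]` of the estimator built on `X i = g (U i)`. -/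
noncomputable def integratedVariance {Ω : Type*} [MeasurableSpace Ω] (μ : Measure Ω) {n s : ℕ}
    (U : Ω → Fin n → Fin s → ℝ) (g : (Fin s → ℝ) → ℝ) (k : ℝ → ℝ) (h a b : ℝ) : ℝ :=
  ∫ x in a..b, ∫ ω, (kde k h (fun i => g (U ω i)) x
    - ∫ ω', kde k h (fun i => g (U ω' i)) x ∂μ) ^ 2 ∂μ

/-- The mean integrated square error over `[a,b]` of the estimator built on `X i = g (U i)`. -/
noncomputable def mise {Ω : Type*} [MeasurableSpace Ω] (μ : Measure Ω) {n s : ℕ}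
    (U : Ω → Fin n → Fin s → ℝ) (g : (Fin s → ℝ) → ℝ) (f k : ℝ → ℝ) (h a b : ℝ) : ℝ :=
  ∫ x in a..b, ∫ ω, (kde k h (fun i => g (U ω i)) x - f x) ^ 2 ∂μ

namespace NestedScrambling

/-- The first `l` terms of a sequence of binary digits. -/
def digitPrefix (x : ℕ → Fin 2) (l : ℕ) : List (Fin 2) := (List.range l).map x

/-- The sign `(-1)^b` of a binary digit. -/
noncomputable def digitSign (b : Fin 2) : ℝ := if b = 0 then 1 else -1

/-- The Haar functions on binary sequences: the constant `1`, and for every finite string `w` the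
function supported on the sequences that extend `w`, with values given by the sign of the next
digit. -/
noncomputable def haar : Option (List (Fin 2)) → (ℕ → Fin 2) → ℝ
  | none, _ => 1
  | some w, x => if digitPrefix x w.length = w then digitSign (x w.length) else 0

/-- Tensor products of Haar functions. -/
noncomputable def tensorHaar {s : ℕ} (W : Fin s → Option (List (Fin 2)))
    (x : Fin s → ℕ → Fin 2) : ℝ :=
  ∏ j, haar (W j) (x j)

lemma haar_none (x : ℕ → Fin 2) : haar none x = 1 := rfl

lemma haar_some (w : List (Fin 2)) (x : ℕ → Fin 2) : haar (some w) x
    = if digitPrefix x w.length = w then digitSign (x w.length) else 0 := rfl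

@[simp] lemma digitPrefix_length (x : ℕ → Fin 2) (l : ℕ) : (digitPrefix x l).length = l := by
  simp [digitPrefix]

lemma digitPrefix_succ (x : ℕ → Fin 2) (l : ℕ) :
    digitPrefix x (l + 1) = digitPrefix x l ++ [x l] := by
  simp [digitPrefix, List.range_succ]

lemma digitPrefix_succ_eq_append_iff (x : ℕ → Fin 2) (l : ℕ) (w : List (Fin 2)) (b : Fin 2) :
    digitPrefix x (l + 1) = w ++ [b] ↔ digitPrefix x l = w ∧ x l = b := by
  rw [digitPrefix_succ]
  constructor
  · intro h
    obtain ⟨h1, h2⟩ := List.append_inj' h rfl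
    exact ⟨h1, by simpa using h2⟩
  · rintro ⟨rfl, rfl⟩
    rfl

lemma digitPrefix_eq_iff {x y : ℕ → Fin 2} {l : ℕ} :
    digitPrefix x l = digitPrefix y l ↔ ∀ i < l, x i = y i := by
  simp [digitPrefix]

lemma digitPrefix_mono {x y : ℕ → Fin 2} {l l' : ℕ} (hl : l ≤ l')
    (h : digitPrefix x l' = digitPrefix y l') : digitPrefix x l = digitPrefix y l := by
  rw [digitPrefix_eq_iff] at *
  exact fun i hi => h i (hi.trans_le hl)

lemma abs_digitSign (b : Fin 2) : |digitSign b| = 1 := by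
  unfold digitSign; split_ifs <;> simp

lemma digitSign_mul_self (b : Fin 2) : digitSign b * digitSign b = 1 := by
  unfold digitSign; split_ifs <;> simp

lemma abs_haar_le_one (o : Option (List (Fin 2))) (x : ℕ → Fin 2) : |haar o x| ≤ 1 := by
  cases o with
  | none => simp [haar]
  | some w =>
    simp only [haar]
    split_ifs
    · exact (abs_digitSign _).le
    · simp

lemma abs_tensorHaar_le_one {s : ℕ} (W : Fin s → Option (List (Fin 2)))
    (x : Fin s → ℕ → Fin 2) : |tensorHaar W x| ≤ 1 := by
  rw [tensorHaar, Finset.abs_prod]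
  exact Finset.prod_le_one (fun _ _ => abs_nonneg _) fun _ _ => abs_haar_le_one _ _

lemma tensorHaar_none {s : ℕ} : tensorHaar (fun _ : Fin s => none) = fun _ => 1 := by
  funext x; simp [tensorHaar, haar]

/-- The indicator of a cylinder is a linear combination of Haar functions. -/
lemma cylinder_mem_span_haar (w : List (Fin 2)) :
    (fun x : ℕ → Fin 2 => if digitPrefix x w.length = w then (1 : ℝ) else 0)
      ∈ Submodule.span ℝ (Set.range haar) := by
  induction w using List.reverseRecOn with
  | nil =>
    have : (fun x : ℕ → Fin 2 => if digitPrefix x ([] : List (Fin 2)).length = [] then (1 : ℝ)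
        else 0) = haar none := by
      funext x; simp [digitPrefix, haar]
    rw [this]
    exact Submodule.subset_span ⟨_, rfl⟩
  | append_singleton w b ih =>
    have h1 : haar (some w) ∈ Submodule.span ℝ (Set.range haar) := Submodule.subset_span ⟨_, rfl⟩
    convert Submodule.add_mem _ (Submodule.smul_mem _ (1 / 2 : ℝ) ih)
      (Submodule.smul_mem _ (digitSign b / 2) h1) using 1
    funext x
    simp only [List.length_append, List.length_singleton, digitPrefix_succ_eq_append_iff,
      Pi.add_apply, Pi.smul_apply, smul_eq_mul, haar, digitSign]
    by_cases h : digitPrefix x w.length = w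
    · generalize x w.length = c
      fin_cases b <;> fin_cases c <;> simp [h] <;> norm_num
    · simp [h]

lemma prod_mem_span_tensorHaar {s : ℕ} (φ : Fin s → (ℕ → Fin 2) → ℝ)
    (h : ∀ j, φ j ∈ Submodule.span ℝ (Set.range haar)) :
    (fun x : Fin s → ℕ → Fin 2 => ∏ j, φ j (x j))
      ∈ Submodule.span ℝ (Set.range (tensorHaar (s := s))) := by
  choose c hc using fun j => Finsupp.mem_span_range_iff_exists_finsupp.1 (h j)
  have key : (fun x : Fin s → ℕ → Fin 2 => ∏ j, φ j (x j))
      = ∑ W ∈ Fintype.piFinset fun j => (c j).support, (∏ j, c j (W j)) • tensorHaar W := by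
    funext x
    simp only [← hc, Finsupp.sum, Finset.sum_apply, Pi.smul_apply, smul_eq_mul, tensorHaar,
      ← Finset.prod_mul_distrib]
    rw [Finset.prod_univ_sum]
  rw [key]
  exact Submodule.sum_mem _ fun W _ => Submodule.smul_mem _ _ (Submodule.subset_span ⟨W, rfl⟩)

/-- A function that depends on finitely many digits is a linear combination of tensor products
of Haar functions. -/
lemma mem_span_tensorHaar {s : ℕ} (L : ℕ) (G : (Fin s → ℕ → Fin 2) → ℝ)
    (hG : ∀ x y, (∀ j, ∀ l < L, x j l = y j l) → G x = G y) :
    G ∈ Submodule.span ℝ (Set.range (tensorHaar (s := s))) := by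
  let e : (Fin s → Fin L → Fin 2) → Fin s → ℕ → Fin 2 := fun w j l =>
    if h : l < L then w j ⟨l, h⟩ else 0
  have key : G = ∑ w, G (e w) • fun x : Fin s → ℕ → Fin 2 =>
      ∏ j, if digitPrefix (x j) (digitPrefix (e w j) L).length = digitPrefix (e w j) L
        then (1 : ℝ) else 0 := by
    funext x
    simp only [Finset.sum_apply, Pi.smul_apply, smul_eq_mul, digitPrefix_length]
    refine Eq.trans ?_ (Finset.sum_eq_single (fun j (l : Fin L) => x j l) ?_ ?_).symm
    · have h1 : ∀ j, ∀ l < L, x j l = e (fun j (l : Fin L) => x j l) j l := by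
        intro j l hl
        simp [e, hl]
      rw [hG _ _ h1, Finset.prod_eq_one, mul_one]
      intro j _
      rw [if_pos (digitPrefix_eq_iff.2 (h1 j))]
    · intro w _ hw
      rw [mul_eq_zero]; right
      by_contra hne
      apply hw
      funext j l
      have := Finset.prod_ne_zero_iff.1 hne j (Finset.mem_univ j)
      have h2 := digitPrefix_eq_iff.1 (by by_contra h; simp [h] at this :
        digitPrefix (x j) L = digitPrefix (e w j) L) l l.2
      rw [h2]; simp [e]
    · simp
  rw [key]
  exact Submodule.sum_mem _ fun w _ => Submodule.smul_mem _ _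
    (prod_mem_span_tensorHaar _ fun j => cylinder_mem_span_haar _)

lemma floor_mul_two_pow_succ (x : ℝ) (l : ℕ) :
    ⌊x * 2 ^ (l + 1)⌋₊ = 2 * ⌊x * 2 ^ l⌋₊ + (Real.digits x 2 l : ℕ) := by
  have h1 : ⌊x * 2 ^ l⌋₊ = ⌊x * 2 ^ (l + 1)⌋₊ / 2 := by
    rw [← Nat.floor_div_ofNat]
    congr 1
    rw [pow_succ]; ring
  have h2 : (Real.digits x 2 l : ℕ) = ⌊x * 2 ^ (l + 1)⌋₊ % 2 := by
    simp [Real.digits, Fin.ofNat]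
  rw [h1, h2]; omega

lemma floor_mul_two_pow_lt {x : ℝ} (hx : x ∈ Set.Ico (0 : ℝ) 1) (l : ℕ) :
    ⌊x * 2 ^ l⌋₊ < 2 ^ l := by
  have hp : (0 : ℝ) < 2 ^ l := by positivity
  rw [Nat.floor_lt (mul_nonneg hx.1 hp.le)]
  push_cast
  nlinarith [hx.2]

/-- The natural number with the given binary digits, most significant digit first. -/
def binaryValue (w : List (Fin 2)) : ℕ := w.foldl (fun n b => 2 * n + (b : ℕ)) 0

lemma binaryValue_append (w : List (Fin 2)) (b : Fin 2) :
    binaryValue (w ++ [b]) = 2 * binaryValue w + b := by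
  simp [binaryValue, List.foldl_append]

lemma binaryValue_lt (w : List (Fin 2)) : binaryValue w < 2 ^ w.length := by
  induction w using List.reverseRecOn with
  | nil => simp [binaryValue]
  | append_singleton w b ih =>
    rw [binaryValue_append, List.length_append, List.length_singleton, pow_succ]
    omega

lemma digitPrefix_digits_eq_iff {x : ℝ} (hx : x ∈ Set.Ico (0 : ℝ) 1) (w : List (Fin 2)) :
    digitPrefix (Real.digits x 2) w.length = w ↔ ⌊x * 2 ^ w.length⌋₊ = binaryValue w := by
  induction w using List.reverseRecOn with
  | nil => simpa [binaryValue, digitPrefix, Nat.floor_eq_zero] using hx.2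
  | append_singleton w b ih =>
    rw [List.length_append, List.length_singleton, digitPrefix_succ_eq_append_iff, ih,
      floor_mul_two_pow_succ, binaryValue_append, Fin.ext_iff]
    have := (Real.digits x 2 w.length).2
    omega

lemma digitPrefix_digits_eq_digitPrefix_iff {x y : ℝ} (hx : x ∈ Set.Ico (0 : ℝ) 1)
    (hy : y ∈ Set.Ico (0 : ℝ) 1) (l : ℕ) :
    digitPrefix (Real.digits x 2) l = digitPrefix (Real.digits y 2) l ↔
      ⌊x * 2 ^ l⌋₊ = ⌊y * 2 ^ l⌋₊ := by
  have h1 := digitPrefix_digits_eq_iff hx (digitPrefix (Real.digits y 2) l)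
  have h2 := digitPrefix_digits_eq_iff hy (digitPrefix (Real.digits y 2) l)
  simp only [digitPrefix_length] at h1 h2
  rw [h1, h2.1 trivial]

lemma mem_dyadic_iff {x : ℝ} (hx : 0 ≤ x) (c l : ℕ) :
    ((c : ℝ) / 2 ^ l ≤ x ∧ x < ((c : ℝ) + 1) / 2 ^ l) ↔ ⌊x * 2 ^ l⌋₊ = c := by
  rw [Nat.floor_eq_iff (by positivity), div_le_iff₀ (by positivity), lt_div_iff₀ (by positivity)]

end NestedScrambling

namespace IsTMSNet

open NestedScrambling

variable {t m s : ℕ} {P : Fin (2 ^ m) → Fin s → ℝ}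

lemma mem_Ico (hP : IsTMSNet t m P) (i : Fin (2 ^ m)) (j : Fin s) :
    P i j ∈ Set.Ico (0 : ℝ) 1 := hP.mem i j

/-- Coarse dyadic boxes contain exactly the expected number of points of the net. -/
lemma card_box (hP : IsTMSNet t m P) (j₀ : Fin s) (e : ℕ) (d : Fin s → ℕ)
    (hd : ∑ j, d j + e = m - t) (c : Fin s → ℕ) (hc : ∀ j, c j < 2 ^ d j) :
    (Finset.univ.filter fun i => ∀ j, ⌊P i j * 2 ^ d j⌋₊ = c j).card = 2 ^ (t + e) := by
  induction e generalizing d c with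
  | zero =>
    have := hP.count d hd c hc
    rw [Nat.card_eq_fintype_card, Fintype.card_subtype] at this
    rw [add_zero, ← this]
    congr 1
    ext i
    simp only [Finset.mem_filter, Finset.mem_univ, true_and, mem_dyadic_iff (hP.mem i _).1]
  | succ e ih =>
    set d' := Function.update d j₀ (d j₀ + 1) with hd'
    have hsum : ∑ j, d' j + e = m - t := by
      rw [hd', Finset.sum_update_of_mem (Finset.mem_univ _)]
      rw [← Finset.add_sum_erase _ _ (Finset.mem_univ j₀)] at hd
      rw [Finset.sdiff_singleton_eq_erase]
      omega
    have hlt : ∀ b < 2, ∀ j, Function.update c j₀ (2 * c j₀ + b) j < 2 ^ d' j := by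
      intro b hb j
      rcases eq_or_ne j j₀ with rfl | hj
      · have := hc j
        simp only [hd', Function.update_self, pow_succ]
        omega
      · simpa [hd', hj] using hc j
    have hsplit : (Finset.univ.filter fun i => ∀ j, ⌊P i j * 2 ^ d j⌋₊ = c j)
        = (Finset.univ.filter fun i => ∀ j, ⌊P i j * 2 ^ d' j⌋₊
            = Function.update c j₀ (2 * c j₀ + 0) j)
        ∪ (Finset.univ.filter fun i => ∀ j, ⌊P i j * 2 ^ d' j⌋₊
            = Function.update c j₀ (2 * c j₀ + 1) j) := by
      ext i
      simp only [Finset.mem_union, Finset.mem_filter, Finset.mem_univ, true_and]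
      have hf := floor_mul_two_pow_succ (P i j₀) (d j₀)
      have hb := (Real.digits (P i j₀) 2 (d j₀)).2
      constructor
      · intro h
        have h0 := h j₀
        have : (Real.digits (P i j₀) 2 (d j₀) : ℕ) = 0 ∨
          (Real.digits (P i j₀) 2 (d j₀) : ℕ) = 1 := by omega
        refine this.imp (fun hb j => ?_) (fun hb j => ?_)
        all_goals
          rcases eq_or_ne j j₀ with rfl | hj
          · simp only [hd', Function.update_self]; omega
          · simpa [hd', hj] using h j
      · rintro (h | h) j
        all_goals
          rcases eq_or_ne j j₀ with rfl | hj
          · have h0 := h j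
            simp only [hd', Function.update_self] at h0; omega
          · simpa [hd', hj] using h j
    rw [hsplit, Finset.card_union_of_disjoint, ih d' hsum _ (hlt 0 (by norm_num)),
      ih d' hsum _ (hlt 1 (by norm_num))]
    · ring
    · rw [Finset.disjoint_left]
      intro i h1 h2
      simp only [Finset.mem_filter, Finset.mem_univ, true_and] at h1 h2
      have := (h1 j₀).symm.trans (h2 j₀)
      simp at this

/-- Fine dyadic boxes contain at most `2 ^ t` points of the net. -/
lemma card_box_le (hP : IsTMSNet t m P) (j₀ : Fin s) (e : ℕ) (d : Fin s → ℕ)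
    (hd : ∑ j, d j = m - t + e) (i : Fin (2 ^ m)) :
    (Finset.univ.filter fun i' => ∀ j, digitPrefix (Real.digits (P i j) 2) (d j)
      = digitPrefix (Real.digits (P i' j) 2) (d j)).card ≤ 2 ^ t := by
  induction e generalizing d with
  | zero =>
    rw [← add_zero t, ← hP.card_box j₀ 0 d (by simpa using hd) (fun j => ⌊P i j * 2 ^ d j⌋₊)
      fun j => floor_mul_two_pow_lt (hP.mem_Ico i j) _]
    refine Finset.card_le_card fun i' => ?_
    simp only [Finset.mem_filter, Finset.mem_univ, true_and]
    exact fun h j =>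
      ((digitPrefix_digits_eq_digitPrefix_iff (hP.mem_Ico i j) (hP.mem_Ico i' j) _).1 (h j)).symm
  | succ e ih =>
    obtain ⟨j, hj⟩ : ∃ j, 0 < d j := by
      by_contra! h
      have : ∑ j, d j = 0 := Finset.sum_eq_zero fun j _ => Nat.le_zero.1 (h j)
      omega
    refine le_trans (Finset.card_le_card fun i' => ?_) (ih (Function.update d j (d j - 1)) ?_)
    · simp only [Finset.mem_filter, Finset.mem_univ, true_and]
      refine fun h j' => digitPrefix_mono ?_ (h j')
      rcases eq_or_ne j' j with rfl | hj'
      · simp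
      · simp [hj']
    · rw [Finset.sum_update_of_mem (Finset.mem_univ _), Finset.sdiff_singleton_eq_erase]
      rw [← Finset.add_sum_erase _ _ (Finset.mem_univ j)] at hd
      omega

end IsTMSNet

namespace NestedScrambling

/-- The contribution of a pair of digit sequences to the gain coefficient of a Haar function. -/
noncomputable def pairGain : Option (List (Fin 2)) → (ℕ → Fin 2) → (ℕ → Fin 2) → ℝ
  | none, _, _ => 1
  | some w, a, a' => if digitPrefix a w.length = digitPrefix a' w.length
      then digitSign (a w.length) * digitSign (a' w.length) else 0

/-- The number of digits that determine the support of a Haar function. -/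
def supportDepth : Option (List (Fin 2)) → ℕ
  | none => 0
  | some w => w.length

/-- The number of digits that determine the values of a Haar function. -/
def valueDepth : Option (List (Fin 2)) → ℕ
  | none => 0
  | some w => w.length + 1

lemma abs_pairGain_le (o : Option (List (Fin 2))) (a a' : ℕ → Fin 2) :
    |pairGain o a a'| ≤
      if digitPrefix a (supportDepth o) = digitPrefix a' (supportDepth o) then 1 else 0 := by
  cases o with
  | none => simp [pairGain, supportDepth, digitPrefix]
  | some w =>
    simp only [pairGain, supportDepth]
    split_ifs with h <;> simp [abs_mul, abs_digitSign, h]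

/-- The signed sum of the indicators of the two children of a cell is `pairGain`. -/
lemma exists_pairGain_eq_sum {x : ℝ} (hx : x ∈ Set.Ico (0 : ℝ) 1) (o : Option (List (Fin 2))) :
    ∃ (ε : Fin 2 → ℝ) (c : Fin 2 → ℕ), (∀ b, c b < 2 ^ valueDepth o) ∧
      (o ≠ none → ∑ b, ε b = 0) ∧ ∀ y ∈ Set.Ico (0 : ℝ) 1,
        pairGain o (Real.digits x 2) (Real.digits y 2)
          = ∑ b, ε b * if ⌊y * 2 ^ valueDepth o⌋₊ = c b then 1 else 0 := by
  cases o with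
  | none =>
    refine ⟨fun _ => 1 / 2, fun _ => 0, by simp [valueDepth], by simp, fun y hy => ?_⟩
    have : ⌊y⌋₊ = 0 := Nat.floor_eq_zero.2 hy.2
    simp [pairGain, valueDepth, this]
  | some w =>
    refine ⟨fun b => digitSign (Real.digits x 2 w.length) * digitSign b,
      fun b => 2 * ⌊x * 2 ^ w.length⌋₊ + b, fun b => ?_, fun _ => ?_, fun y hy => ?_⟩
    · have := floor_mul_two_pow_lt hx w.length
      simp only [valueDepth, pow_succ]
      omega
    · simp [digitSign]
    · simp only [pairGain, valueDepth, floor_mul_two_pow_succ,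
        digitPrefix_digits_eq_digitPrefix_iff hx hy]
      generalize Real.digits y 2 w.length = b
      generalize ⌊x * 2 ^ w.length⌋₊ = p
      generalize ⌊y * 2 ^ w.length⌋₊ = q
      have e1 : ¬ (2 * q + 1 = 2 * p) := by omega
      have e2 : ¬ (2 * q = 2 * p + 1) := by omega
      have e3 : (q = p) = (p = q) := propext eq_comm
      fin_cases b <;> simp [e1, e2, e3]

/-- The gain coefficients of a net: row sums. -/
lemma abs_sum_prod_pairGain_le {t m s : ℕ} {P : Fin (2 ^ m) → Fin s → ℝ} (hP : IsTMSNet t m P)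
    (W : Fin s → Option (List (Fin 2))) (j₀ : Fin s) (hW : W j₀ ≠ none) (i : Fin (2 ^ m)) :
    |∑ i', ∏ j, pairGain (W j) (Real.digits (P i j) 2) (Real.digits (P i' j) 2)|
      ≤ 2 ^ (t + s) := by
  rcases le_or_gt (∑ j, valueDepth (W j)) (m - t) with hle | hlt
  · choose ε c hc hε hs using fun j => exists_pairGain_eq_sum (hP.mem_Ico i j) (W j)
    obtain ⟨e, he⟩ := Nat.exists_eq_add_of_le hle
    have : ∑ i', ∏ j, pairGain (W j) (Real.digits (P i j) 2) (Real.digits (P i' j) 2) = 0 := by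
      calc _ = ∑ i', ∑ b : Fin s → Fin 2, ∏ j, (ε j (b j) *
              if ⌊P i' j * 2 ^ valueDepth (W j)⌋₊ = c j (b j) then 1 else 0) := by
            refine Finset.sum_congr rfl fun i' _ => ?_
            rw [Finset.prod_congr rfl fun j _ => hs j _ (hP.mem_Ico i' j), Finset.prod_univ_sum,
              Fintype.piFinset_univ]
        _ = ∑ b : Fin s → Fin 2, (∏ j, ε j (b j)) * 2 ^ (t + e) := by
            rw [Finset.sum_comm]
            refine Finset.sum_congr rfl fun b _ => ?_
            have := hP.card_box j₀ e (fun j => valueDepth (W j)) he.symm (fun j => c j (b j))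
              fun j => hc j _
            simp only [Finset.prod_mul_distrib, ← Finset.mul_sum]
            congr 1
            have h2 : ((2 ^ (t + e) : ℕ) : ℝ) = 2 ^ (t + e) := by push_cast; rfl
            rw [← h2, ← this, Finset.card_filter, Nat.cast_sum]
            refine Finset.sum_congr rfl fun i' _ => ?_
            rw [Finset.prod_ite_zero]
            simp
        _ = 0 := by
            rw [← Finset.sum_mul]
            have : ∏ j, ∑ b, ε j b = 0 :=
              Finset.prod_eq_zero (Finset.mem_univ j₀) (hε j₀ hW)
            rw [Finset.prod_univ_sum, Fintype.piFinset_univ] at this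
            rw [this, zero_mul]
    rw [this]; simp
  · have hcard : (Finset.univ.filter fun i' => ∀ j, digitPrefix (Real.digits (P i j) 2)
        (supportDepth (W j)) = digitPrefix (Real.digits (P i' j) 2) (supportDepth (W j))).card
        ≤ 2 ^ (t + s) := by
      have hds : ∑ j, valueDepth (W j) ≤ ∑ j, supportDepth (W j) + s := by
        calc _ ≤ ∑ j : Fin s, (supportDepth (W j) + 1) := Finset.sum_le_sum fun j _ => by
                cases W j <;> simp [valueDepth, supportDepth]
          _ = _ := by simp [Finset.sum_add_distrib]
      rcases le_total (∑ j, supportDepth (W j)) (m - t) with h | h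
      · obtain ⟨e, he⟩ := Nat.exists_eq_add_of_le h
        calc _ = 2 ^ (t + e) := by
                rw [← hP.card_box j₀ e (fun j => supportDepth (W j)) he.symm
                  (fun j => ⌊P i j * 2 ^ supportDepth (W j)⌋₊)
                  fun j => floor_mul_two_pow_lt (hP.mem_Ico i j) _]
                congr 1
                ext i'
                simp only [Finset.mem_filter, Finset.mem_univ, true_and]
                exact forall_congr' fun j => (digitPrefix_digits_eq_digitPrefix_iff
                  (hP.mem_Ico i j) (hP.mem_Ico i' j) _).trans eq_comm
          _ ≤ _ := Nat.pow_le_pow_right (by norm_num) (by omega)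
      · obtain ⟨e, he⟩ := Nat.exists_eq_add_of_le h
        exact (hP.card_box_le j₀ e _ he i).trans (Nat.pow_le_pow_right (by norm_num) (by omega))
    calc _ ≤ ∑ i', |∏ j, pairGain (W j) (Real.digits (P i j) 2) (Real.digits (P i' j) 2)| :=
          Finset.abs_sum_le_sum_abs _ _
      _ ≤ ∑ i', if ∀ j, digitPrefix (Real.digits (P i j) 2) (supportDepth (W j))
            = digitPrefix (Real.digits (P i' j) 2) (supportDepth (W j)) then (1 : ℝ) else 0 := by
          refine Finset.sum_le_sum fun i' _ => ?_
          rw [Finset.abs_prod]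
          refine (Finset.prod_le_prod (fun _ _ => abs_nonneg _)
            fun j _ => abs_pairGain_le (W j) _ _).trans (le_of_eq ?_)
          rw [Finset.prod_ite_zero]
          simp
      _ ≤ 2 ^ (t + s) := by
          rw [Finset.sum_boole]
          exact_mod_cast hcard

/-! ### Cylinder functions -/

/-- A function of binary sequences that depends on finitely many digits only. -/
def IsCylinder {s : ℕ} (G : (Fin s → ℕ → Fin 2) → ℝ) : Prop :=
  ∃ L, ∀ x y : Fin s → ℕ → Fin 2, (∀ j, ∀ l < L, x j l = y j l) → G x = G y

lemma IsCylinder.comp₂ {s : ℕ} {G H : (Fin s → ℕ → Fin 2) → ℝ} (hG : IsCylinder G)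
    (hH : IsCylinder H) (f : ℝ → ℝ → ℝ) : IsCylinder fun x => f (G x) (H x) := by
  obtain ⟨L, hL⟩ := hG
  obtain ⟨L', hL'⟩ := hH
  refine ⟨max L L', fun x y h => ?_⟩
  change f (G x) (H x) = f (G y) (H y)
  rw [hL x y fun j l hl => h j l (lt_max_of_lt_left hl),
    hL' x y fun j l hl => h j l (lt_max_of_lt_right hl)]

lemma haar_congr {o : Option (List (Fin 2))} {x y : ℕ → Fin 2}
    (h : ∀ l < valueDepth o, x l = y l) : haar o x = haar o y := by
  cases o with
  | none => rfl
  | some w =>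
    have h1 : digitPrefix x w.length = digitPrefix y w.length :=
      digitPrefix_eq_iff.2 fun i hi => h i (Nat.lt_succ_of_lt hi)
    simp only [haar, h1, h w.length (Nat.lt_succ_self _)]

lemma isCylinder_tensorHaar {s : ℕ} (W : Fin s → Option (List (Fin 2))) :
    IsCylinder (tensorHaar W) := by
  refine ⟨∑ j, valueDepth (W j), fun x y h => Finset.prod_congr rfl fun j _ => haar_congr ?_⟩
  exact fun l hl => h j l (hl.trans_le
    (Finset.single_le_sum (f := fun j => valueDepth (W j)) (fun _ _ => Nat.zero_le _)
      (Finset.mem_univ j)))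

lemma IsCylinder.exists_eq_sum {s : ℕ} {G : (Fin s → ℕ → Fin 2) → ℝ} (hG : IsCylinder G) :
    ∃ (S : Finset (Fin s → Option (List (Fin 2)))) (c : (Fin s → Option (List (Fin 2))) → ℝ),
      ∀ x, G x = ∑ W ∈ S, c W * tensorHaar W x := by
  obtain ⟨L, hL⟩ := hG
  obtain ⟨c, hc⟩ := Finsupp.mem_span_range_iff_exists_finsupp.1 (mem_span_tensorHaar L G hL)
  refine ⟨c.support, c, fun x => ?_⟩
  rw [← hc, Finsupp.sum, Finset.sum_apply]
  rfl

lemma measurableSet_digitPrefix_eq (w : List (Fin 2)) :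
    MeasurableSet {x : ℕ → Fin 2 | digitPrefix x w.length = w} := by
  induction w using List.reverseRecOn with
  | nil => simp [digitPrefix]
  | append_singleton w b ih =>
    simp only [List.length_append, List.length_singleton, digitPrefix_succ_eq_append_iff]
    exact ih.inter ((measurable_pi_apply (X := fun _ : ℕ => Fin 2) w.length)
      (measurableSet_singleton b))

lemma measurable_haar (o : Option (List (Fin 2))) : Measurable (haar o) := by
  cases o with
  | none => exact measurable_const
  | some w =>
    exact Measurable.ite (measurableSet_digitPrefix_eq w)
      ((measurable_of_countable digitSign).comp (measurable_pi_apply _)) measurable_const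

lemma measurable_tensorHaar {s : ℕ} (W : Fin s → Option (List (Fin 2))) :
    Measurable (tensorHaar W) :=
  Finset.measurable_prod _ fun j _ => (measurable_haar (W j)).comp (measurable_pi_apply j)

/-! ### Digits of uniform points -/

instance isProbabilityMeasure_uniformCube (s : ℕ) : IsProbabilityMeasure (uniformCube s) := by
  constructor
  rw [uniformCube, Measure.restrict_apply_univ, volume_pi_pi]
  simp

lemma measurable_digits : Measurable fun x : ℝ => Real.digits x 2 := by
  refine measurable_pi_iff.2 fun l => ?_
  exact (measurable_of_countable (fun k : ℕ => Fin.ofNat 2 k)).comp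
    (Nat.measurable_floor.comp (measurable_id.mul_const _))

lemma measurable_digits_pi {s : ℕ} :
    Measurable fun (x : Fin s → ℝ) (j : Fin s) => Real.digits (x j) 2 :=
  measurable_pi_iff.2 fun j => measurable_digits.comp (measurable_pi_apply j)

lemma integral_indicator_digitPrefix (w : List (Fin 2)) :
    ∫ x in Set.Ico (0 : ℝ) 1,
      (if digitPrefix (Real.digits x 2) w.length = w then (1 : ℝ) else 0) = (1 / 2) ^ w.length := by
  have hp : (0 : ℝ) < 2 ^ w.length := by positivity
  have hlt : (binaryValue w : ℝ) + 1 ≤ 2 ^ w.length := by exact_mod_cast binaryValue_lt w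
  have hset : ∀ x ∈ Set.Ico (0 : ℝ) 1,
      (if digitPrefix (Real.digits x 2) w.length = w then (1 : ℝ) else 0)
      = Set.indicator (Set.Ico ((binaryValue w : ℝ) / 2 ^ w.length)
        (((binaryValue w : ℝ) + 1) / 2 ^ w.length)) 1 x := by
    intro x hx
    simp only [Set.indicator_apply, Set.mem_Ico, mem_dyadic_iff hx.1,
      digitPrefix_digits_eq_iff hx, Pi.one_apply]
  rw [setIntegral_congr_fun measurableSet_Ico hset,
    setIntegral_indicator measurableSet_Ico, Set.inter_eq_right.2]
  · simp only [Pi.one_apply, integral_const, smul_eq_mul, mul_one, measureReal_restrict_apply_univ,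
      Real.volume_real_Ico]
    rw [← sub_div, add_sub_cancel_left, max_eq_left (by positivity), one_div_pow]
  · intro x hx
    refine ⟨le_trans (by positivity) hx.1, hx.2.trans_le ?_⟩
    rwa [div_le_one hp]

lemma integral_haar_digits (w : List (Fin 2)) :
    ∫ x in Set.Ico (0 : ℝ) 1, haar (some w) (Real.digits x 2) = 0 := by
  have key : ∀ y : ℕ → Fin 2, haar (some w) y
      = (if digitPrefix y (w ++ [0]).length = w ++ [0] then 1 else 0)
        - (if digitPrefix y (w ++ [1]).length = w ++ [1] then 1 else 0) := by
    intro y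
    simp only [List.length_append, List.length_singleton, digitPrefix_succ_eq_append_iff, haar]
    generalize y w.length = b
    by_cases h : digitPrefix y w.length = w <;> fin_cases b <;> simp [h, digitSign]
  have hint : ∀ v : List (Fin 2), IntegrableOn (fun x : ℝ =>
      if digitPrefix (Real.digits x 2) v.length = v then (1 : ℝ) else 0) (Set.Ico 0 1) := by
    intro v
    refine Measure.integrableOn_of_bounded (M := 1) (by simp) ?_ ?_
    · exact (Measurable.ite (measurable_digits (measurableSet_digitPrefix_eq v)) measurable_const
        measurable_const).aestronglyMeasurable
    · filter_upwards with x
      split_ifs <;> simp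
  simp only [key]
  rw [integral_sub (hint _) (hint _), integral_indicator_digitPrefix,
    integral_indicator_digitPrefix]
  simp

lemma integral_tensorHaar_digits {s : ℕ} (W : Fin s → Option (List (Fin 2)))
    (hW : W ≠ fun _ => none) :
    ∫ x, tensorHaar W (fun j => Real.digits (x j) 2) ∂(uniformCube s) = 0 := by
  obtain ⟨j, hj⟩ := Function.ne_iff.1 hW
  obtain ⟨w, hw⟩ := Option.ne_none_iff_exists'.1 hj
  rw [uniformCube, volume_pi, Measure.restrict_pi_pi]
  simp only [tensorHaar]
  rw [integral_fintype_prod_eq_prod (f := fun j x => haar (W j) (Real.digits x 2))]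
  refine Finset.prod_eq_zero (Finset.mem_univ j) ?_
  rw [hw, ← setIntegral_congr_set Ico_ae_eq_Icc]
  exact integral_haar_digits w

/-- Nested scramble of an array of digits, coordinate by coordinate. -/
def scrambleArray {s : ℕ} (p : Fin s → List (Fin 2) → Equiv.Perm (Fin 2))
    (a : Fin s → ℕ → Fin 2) : Fin s → ℕ → Fin 2 :=
  fun j => scrambleDigits (p j) (a j)

lemma scrambleDigits_apply (p : List (Fin 2) → Equiv.Perm (Fin 2)) (x : ℕ → Fin 2) (l : ℕ) :
    scrambleDigits p x l = p (digitPrefix x l) (x l) := rfl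

lemma digitPrefix_scrambleDigits_congr {p p' : List (Fin 2) → Equiv.Perm (Fin 2)} {x : ℕ → Fin 2}
    {L : ℕ} (h : ∀ l < L, p (digitPrefix x l) = p' (digitPrefix x l)) :
    digitPrefix (scrambleDigits p x) L = digitPrefix (scrambleDigits p' x) L := by
  refine digitPrefix_eq_iff.2 fun l hl => ?_
  rw [scrambleDigits_apply, scrambleDigits_apply, h l hl]

lemma haar_scrambleDigits_congr {p p' : List (Fin 2) → Equiv.Perm (Fin 2)} {x : ℕ → Fin 2}
    {o : Option (List (Fin 2))}
    (h : ∀ l < valueDepth o, p (digitPrefix x l) = p' (digitPrefix x l)) :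
    haar o (scrambleDigits p x) = haar o (scrambleDigits p' x) := by
  refine haar_congr fun l hl => ?_
  rw [scrambleDigits_apply, scrambleDigits_apply, h l hl]

/-- Points that share a prefix still share it after scrambling. -/
lemma digitPrefix_scrambleDigits_eq (p : List (Fin 2) → Equiv.Perm (Fin 2)) {x y : ℕ → Fin 2}
    {L : ℕ} (h : digitPrefix x L = digitPrefix y L) :
    digitPrefix (scrambleDigits p x) L = digitPrefix (scrambleDigits p y) L := by
  refine digitPrefix_eq_iff.2 fun l hl => ?_
  rw [scrambleDigits_apply, scrambleDigits_apply, digitPrefix_mono hl.le h,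
    digitPrefix_eq_iff.1 h l hl]

lemma digitSign_perm_mul (σ : Equiv.Perm (Fin 2)) (b c : Fin 2) :
    digitSign (σ b) * digitSign (σ c) = digitSign b * digitSign c := by
  have h : ∀ b c : Fin 2, digitSign b * digitSign c = if b = c then 1 else -1 := by
    intro b c
    fin_cases b <;> fin_cases c <;> simp [digitSign]
  simp [h]

lemma sum_digitSign_perm (b : Fin 2) : ∑ σ : Equiv.Perm (Fin 2), digitSign (σ b) = 0 := by
  have h := Equiv.sum_comp (Equiv.mulLeft (Equiv.swap (0 : Fin 2) 1))
    fun σ : Equiv.Perm (Fin 2) => digitSign (σ b)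
  have h2 : ∀ c : Fin 2, digitSign (Equiv.swap (0 : Fin 2) 1 c) = - digitSign c := by
    intro c
    fin_cases c <;> simp [digitSign]
  simp only [Equiv.coe_mulLeft, Equiv.Perm.mul_apply, h2, Finset.sum_neg_distrib] at h
  linarith

lemma measurable_scrambleArray {Ω : Type*} [MeasurableSpace Ω] {μ : Measure Ω} {s : ℕ}
    {π : Ω → Fin s → List (Fin 2) → Equiv.Perm (Fin 2)} (hπ : IsUniformScrambling μ π)
    (a : Fin s → ℕ → Fin 2) :
    Measurable fun ω => scrambleArray (π ω) a := by
  refine measurable_pi_iff.2 fun j => measurable_pi_iff.2 fun l => ?_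
  let _ : MeasurableSpace (Equiv.Perm (Fin 2)) := ⊤
  have h : Measurable fun ω => π ω j (digitPrefix (a j) l) :=
    measurable_to_countable' fun σ => hπ.meas j _ σ
  exact (measurable_of_countable fun σ : Equiv.Perm (Fin 2) => σ (a j l)).comp h

section Scrambling

variable {Ω : Type*} [MeasurableSpace Ω] {μ : Measure Ω} [IsProbabilityMeasure μ] {s : ℕ}
  {π : Ω → Fin s → List (Fin 2) → Equiv.Perm (Fin 2)}

/-- The permutation at a node is independent of those at finitely many other nodes. -/
lemma integral_mul_perm_eq_zero (hπ : IsUniformScrambling μ π) (S : Finset (Fin s × List (Fin 2)))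
    (q : Fin s × List (Fin 2)) (hq : q ∉ S)
    (Φ : (Fin s → List (Fin 2) → Equiv.Perm (Fin 2)) → ℝ)
    (hΦ : ∀ p p', (∀ r ∈ S, p r.1 r.2 = p' r.1 r.2) → Φ p = Φ p')
    (ψ : Equiv.Perm (Fin 2) → ℝ) (hψ : ∑ σ, ψ σ = 0) :
    ∫ ω, Φ (π ω) * ψ (π ω q.1 q.2) ∂μ = 0 := by
  classical
  let _ : MeasurableSpace (Equiv.Perm (Fin 2)) := ⊤
  have hm : ∀ r : Fin s × List (Fin 2), Measurable fun ω => π ω r.1 r.2 :=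
    fun r => measurable_to_countable' fun σ => hπ.meas r.1 r.2 σ
  let Ψ : (S → Equiv.Perm (Fin 2)) → ℝ := fun v =>
    Φ fun j w => if h : (j, w) ∈ S then v ⟨_, h⟩ else 1
  have hΨ : ∀ ω, Φ (π ω) = Ψ fun r => π ω r.1.1 r.1.2 := by
    intro ω
    refine hΦ _ _ fun r hr => ?_
    simp [hr]
  have hind := iIndepFun.indepFun_finset S {q} (by simpa using hq) hπ.indep hm
  have hind2 : IndepFun (fun ω => Φ (π ω)) (fun ω => ψ (π ω q.1 q.2)) μ := by
    simp only [hΨ]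
    exact hind.comp (φ := Ψ) (ψ := fun v => ψ (v ⟨q, Finset.mem_singleton_self q⟩))
      (measurable_of_countable _) (measurable_of_countable _)
  have hψm : Measurable fun ω => ψ (π ω q.1 q.2) := (measurable_of_countable ψ).comp (hm q)
  have hΦm : Measurable fun ω => Φ (π ω) := by
    simp only [hΨ]
    exact (measurable_of_countable Ψ).comp (measurable_pi_iff.2 fun r => hm r.1)
  rw [hind2.integral_fun_mul_eq_mul_integral hΦm.aestronglyMeasurable hψm.aestronglyMeasurable]
  have hz : ∫ ω, ψ (π ω q.1 q.2) ∂μ = 0 := by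
    have h1 : ∀ ω, ψ (π ω q.1 q.2)
        = ∑ σ, Set.indicator {ω | π ω q.1 q.2 = σ} (fun _ => ψ σ) ω := by
      intro ω
      simp [Set.indicator_apply]
    simp only [h1]
    rw [integral_finsetSum _ fun σ _ => (integrable_const _).indicator (hπ.meas _ _ _)]
    have h2 : ∀ σ, ∫ ω, Set.indicator {ω | π ω q.1 q.2 = σ} (fun _ => ψ σ) ω ∂μ
        = 1 / 2 * ψ σ := by
      intro σ
      rw [integral_indicator_const _ (hπ.meas _ _ _), Measure.real, hπ.unif]
      simp
    simp only [h2, ← Finset.mul_sum, hψ, mul_zero]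
  rw [hz, mul_zero]

lemma integral_tensorHaar_mul_eq_zero_of_deeper (hπ : IsUniformScrambling μ π)
    (a a' : Fin s → ℕ → Fin 2) (W W' : Fin s → Option (List (Fin 2))) (j : Fin s)
    (w : List (Fin 2)) (hw : W j = some w)
    (h' : ∀ w', W' j = some w' → w'.length ≤ w.length ∧
      digitPrefix (a j) w.length ≠ digitPrefix (a' j) w'.length) :
    ∫ ω, tensorHaar W (scrambleArray (π ω) a) * tensorHaar W' (scrambleArray (π ω) a') ∂μ = 0 := by
  classical
  set q : Fin s × List (Fin 2) := (j, digitPrefix (a j) w.length) with hq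
  let S : Finset (Fin s × List (Fin 2)) :=
    (Finset.univ.biUnion fun j' =>
      (Finset.range (valueDepth (W j'))).image (fun l => (j', digitPrefix (a j') l))
      ∪ (Finset.range (valueDepth (W' j'))).image (fun l => (j', digitPrefix (a' j') l))).erase q
  have hS : ∀ r ∈ S, r ≠ q := fun r hr => Finset.ne_of_mem_erase hr
  have hSa : ∀ j', ∀ l < valueDepth (W j'), (j', digitPrefix (a j') l) ≠ q →
      (j', digitPrefix (a j') l) ∈ S := by
    intro j' l hl hne
    refine Finset.mem_erase.2 ⟨hne, Finset.mem_biUnion.2 ⟨j', Finset.mem_univ _, ?_⟩⟩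
    exact Finset.mem_union_left _ (Finset.mem_image.2 ⟨l, Finset.mem_range.2 hl, rfl⟩)
  have hSa' : ∀ j', ∀ l < valueDepth (W' j'), (j', digitPrefix (a' j') l) ≠ q →
      (j', digitPrefix (a' j') l) ∈ S := by
    intro j' l hl hne
    refine Finset.mem_erase.2 ⟨hne, Finset.mem_biUnion.2 ⟨j', Finset.mem_univ _, ?_⟩⟩
    exact Finset.mem_union_right _ (Finset.mem_image.2 ⟨l, Finset.mem_range.2 hl, rfl⟩)
  let Φ : (Fin s → List (Fin 2) → Equiv.Perm (Fin 2)) → ℝ := fun p =>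
    (∏ j' ∈ Finset.univ.erase j, haar (W j') (scrambleDigits (p j') (a j'))) *
      (if digitPrefix (scrambleDigits (p j) (a j)) w.length = w then 1 else 0) *
      tensorHaar W' (scrambleArray p a')
  have key := integral_mul_perm_eq_zero hπ S q (fun h => hS q h rfl) Φ ?_
    (fun σ => digitSign (σ (a j w.length))) (sum_digitSign_perm _)
  · rw [← key]
    congr 1
    funext ω
    simp only [Φ]
    rw [tensorHaar, ← Finset.prod_erase_mul _ _ (Finset.mem_univ j), hw]
    simp only [scrambleArray, haar_some, scrambleDigits_apply, hq]
    by_cases h : digitPrefix (scrambleDigits (π ω j) (a j)) w.length = w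
    · rw [if_pos h, if_pos h]; ring
    · rw [if_neg h, if_neg h]; ring
  · intro p p' hp
    simp only [Φ]
    congr 1
    · congr 1
      · refine Finset.prod_congr rfl fun j' hj' => haar_scrambleDigits_congr fun l hl => ?_
        refine hp _ (hSa j' l hl fun h => ?_)
        exact Finset.ne_of_mem_erase hj' (congrArg Prod.fst h)
      · rw [digitPrefix_scrambleDigits_congr fun l hl => ?_]
        refine hp _ (hSa j l (by rw [hw]; exact Nat.lt_succ_of_lt hl) fun h => ?_)
        have := congrArg (fun r : Fin s × List (Fin 2) => r.2.length) h
        simp [hq] at this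
        omega
    · refine Finset.prod_congr rfl fun j' _ => haar_scrambleDigits_congr fun l hl => ?_
      refine hp _ (hSa' j' l hl fun h => ?_)
      obtain rfl : j' = j := congrArg Prod.fst h
      have h2 : digitPrefix (a' j') l = digitPrefix (a j') w.length := congrArg Prod.snd h
      have h3 : l = w.length := by simpa using congrArg List.length h2
      rcases hW' : W' j' with _ | w'
      · rw [hW'] at hl
        exact absurd hl (Nat.not_lt_zero _)
      · rw [hW'] at hl
        have h4 := h' w' hW'
        have h5 : l = w'.length := by
          have : l < w'.length + 1 := hl
          omega
        exact h4.2 (by rw [← h2, h5])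

/-- Distinct Haar functions of scrambled points are uncorrelated. -/
lemma integral_tensorHaar_mul_eq_zero (hπ : IsUniformScrambling μ π)
    (a a' : Fin s → ℕ → Fin 2) {W W' : Fin s → Option (List (Fin 2))} (hne : W ≠ W') :
    ∫ ω, tensorHaar W (scrambleArray (π ω) a) * tensorHaar W' (scrambleArray (π ω) a') ∂μ = 0 := by
  obtain ⟨j, hj⟩ := Function.ne_iff.1 hne
  rcases hW : W j with _ | w <;> rcases hW' : W' j with _ | w'
  · exact absurd (hW.trans hW'.symm) hj
  · simp only [mul_comm (tensorHaar W _)]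
    exact integral_tensorHaar_mul_eq_zero_of_deeper hπ a' a W' W j w' hW' (by simp [hW])
  · exact integral_tensorHaar_mul_eq_zero_of_deeper hπ a a' W W' j w hW (by simp [hW'])
  · by_cases hp : digitPrefix (a j) w.length = digitPrefix (a' j) w'.length
    · have hl : w.length = w'.length := by simpa using congrArg List.length hp
      have : ∀ ω, tensorHaar W (scrambleArray (π ω) a)
          * tensorHaar W' (scrambleArray (π ω) a') = 0 := by
        intro ω
        rw [tensorHaar, tensorHaar, ← Finset.prod_mul_distrib]
        refine Finset.prod_eq_zero (Finset.mem_univ j) ?_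
        rw [← hl] at hp
        have h2 := digitPrefix_scrambleDigits_eq (π ω j) hp
        simp only [hW, hW', haar, scrambleArray, ← hl, ← h2]
        split_ifs with h3 h4
        · exact absurd (by rw [hW, hW', ← h3, ← h4]) hj
        all_goals simp
      simp [this]
    · rcases le_total w'.length w.length with hle | hle
      · refine integral_tensorHaar_mul_eq_zero_of_deeper hπ a a' W W' j w hW fun v hv => ?_
        obtain rfl : w' = v := Option.some_injective _ (hW'.symm.trans hv)
        exact ⟨hle, hp⟩
      · simp only [mul_comm (tensorHaar W _)]
        refine integral_tensorHaar_mul_eq_zero_of_deeper hπ a' a W' W j w' hW' fun v hv => ?_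
        obtain rfl : w = v := Option.some_injective _ (hW.symm.trans hv)
        exact ⟨hle, fun h => hp h.symm⟩

lemma integral_tensorHaar_mul_self (hπ : IsUniformScrambling μ π) (a a' : Fin s → ℕ → Fin 2)
    (W : Fin s → Option (List (Fin 2))) :
    ∫ ω, tensorHaar W (scrambleArray (π ω) a) * tensorHaar W (scrambleArray (π ω) a') ∂μ
      = (∏ j, pairGain (W j) (a j) (a' j))
        * ∫ ω, tensorHaar W (scrambleArray (π ω) a) ^ 2 ∂μ := by
  by_cases h : ∃ j w, W j = some w ∧ digitPrefix (a j) w.length ≠ digitPrefix (a' j) w.length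
  · obtain ⟨j, w, hw, hne⟩ := h
    rw [integral_tensorHaar_mul_eq_zero_of_deeper hπ a a' W W j w hw,
      Finset.prod_eq_zero (Finset.mem_univ j), zero_mul]
    · rw [hw]
      simp [pairGain, hne]
    · intro v hv
      obtain rfl : w = v := Option.some_injective _ (hw.symm.trans hv)
      exact ⟨le_rfl, hne⟩
  · push Not at h
    rw [← integral_const_mul]
    congr 1
    funext ω
    simp only [tensorHaar]
    rw [sq, ← Finset.prod_mul_distrib, ← Finset.prod_mul_distrib, ← Finset.prod_mul_distrib]
    refine Finset.prod_congr rfl fun j _ => ?_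
    change haar _ (scrambleDigits (π ω j) (a j)) * haar _ (scrambleDigits (π ω j) (a' j))
      = _ * (haar _ (scrambleDigits (π ω j) (a j)) * haar _ (scrambleDigits (π ω j) (a j)))
    rcases hW : W j with _ | w
    · simp [haar_none, pairGain]
    · have hp := h j w hW
      have h2 := digitPrefix_scrambleDigits_eq (π ω j) hp
      simp only [haar_some, pairGain, ← h2, if_pos hp]
      by_cases h : digitPrefix (scrambleDigits (π ω j) (a j)) w.length = w
      · simp only [if_pos h]
        rw [scrambleDigits_apply, scrambleDigits_apply, ← hp, digitSign_perm_mul,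
          digitSign_mul_self, mul_one]
      · simp only [if_neg h, mul_zero]

lemma integrable_tensorHaar_scramble (hπ : IsUniformScrambling μ π) (a : Fin s → ℕ → Fin 2)
    (W : Fin s → Option (List (Fin 2))) :
    Integrable (fun ω => tensorHaar W (scrambleArray (π ω) a)) μ :=
  Integrable.of_bound
    ((measurable_tensorHaar W).comp (measurable_scrambleArray hπ a)).aestronglyMeasurable 1
    (ae_of_all _ fun _ => abs_tensorHaar_le_one _ _)

lemma integral_tensorHaar_scramble_eq_zero (hπ : IsUniformScrambling μ π) (a : Fin s → ℕ → Fin 2)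
    {W : Fin s → Option (List (Fin 2))} (hW : W ≠ fun _ => none) :
    ∫ ω, tensorHaar W (scrambleArray (π ω) a) ∂μ = 0 := by
  have := integral_tensorHaar_mul_eq_zero hπ a a hW
  simpa [tensorHaar_none] using this

/-- Each scrambled point has uniformly distributed digits. -/
lemma IsCylinder.integral_scramble {G : (Fin s → ℕ → Fin 2) → ℝ} (hG : IsCylinder G)
    (hπ : IsUniformScrambling μ π) (a : Fin s → ℕ → Fin 2) :
    ∫ ω, G (scrambleArray (π ω) a) ∂μ
      = ∫ x, G (fun j => Real.digits (x j) 2) ∂(uniformCube s) := by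
  obtain ⟨S, c, hc⟩ := hG.exists_eq_sum
  simp only [hc]
  rw [integral_finsetSum _ fun W _ => (integrable_tensorHaar_scramble hπ a W).const_mul _,
    integral_finsetSum]
  · refine Finset.sum_congr rfl fun W _ => ?_
    rw [integral_const_mul, integral_const_mul]
    by_cases hW : W = fun _ => none
    · rw [hW, tensorHaar_none]; simp
    · rw [integral_tensorHaar_scramble_eq_zero hπ a hW, integral_tensorHaar_digits W hW]
  · intro W _
    exact (Integrable.of_bound ((measurable_tensorHaar W).comp
      measurable_digits_pi).aestronglyMeasurable 1
      (ae_of_all _ fun _ => abs_tensorHaar_le_one _ _)).const_mul _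

lemma integral_sq_sum_of_orthogonal {ι : Type*} (S : Finset ι) (T : ι → Ω → ℝ)
    (hT : ∀ i, Measurable (T i)) (B : ℝ) (hB : ∀ i ω, |T i ω| ≤ B)
    (horth : ∀ i j, i ≠ j → ∫ ω, T i ω * T j ω ∂μ = 0) (c : ι → ℝ) :
    ∫ ω, (∑ i ∈ S, c i * T i ω) ^ 2 ∂μ = ∑ i ∈ S, c i ^ 2 * ∫ ω, T i ω ^ 2 ∂μ := by
  classical
  have hint : ∀ i j, Integrable (fun ω => T i ω * T j ω) μ := by
    intro i j
    refine Integrable.of_bound ((hT i).mul (hT j)).aestronglyMeasurable (B * B)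
      (ae_of_all _ fun ω => ?_)
    rw [Real.norm_eq_abs, abs_mul]
    exact mul_le_mul (hB i ω) (hB j ω) (abs_nonneg _) ((abs_nonneg _).trans (hB i ω))
  have h1 : ∀ ω, (∑ i ∈ S, c i * T i ω) ^ 2
      = ∑ i ∈ S, ∑ j ∈ S, c i * c j * (T i ω * T j ω) := by
    intro ω
    rw [sq, Finset.sum_mul_sum]
    refine Finset.sum_congr rfl fun i _ => Finset.sum_congr rfl fun j _ => by ring
  simp only [h1]
  rw [integral_finsetSum _ fun i _ => integrable_finsetSum _ fun j _ => (hint i j).const_mul _]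
  refine Finset.sum_congr rfl fun i hi => ?_
  rw [integral_finsetSum _ fun j _ => (hint i j).const_mul _, Finset.sum_eq_single i]
  · rw [integral_const_mul, sq]
    simp only [sq]
  · intro j _ hj
    rw [integral_const_mul, horth i j hj.symm, mul_zero]
  · exact fun h => absurd hi h

end Scrambling

/-- Owen's variance bound for scrambled nets, for functions of finitely many digits. -/
lemma IsCylinder.integral_sq_sum_sub_le {Ω : Type*} [MeasurableSpace Ω] {μ : Measure Ω}
    [IsProbabilityMeasure μ] {s t m : ℕ} {π : Ω → Fin s → List (Fin 2) → Equiv.Perm (Fin 2)}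
    (hπ : IsUniformScrambling μ π) {P : Fin (2 ^ m) → Fin s → ℝ} (hP : IsTMSNet t m P)
    {G : (Fin s → ℕ → Fin 2) → ℝ} (hG : IsCylinder G) :
    ∫ ω, (∑ i, G (scrambleArray (π ω) fun j => Real.digits (P i j) 2)
        - 2 ^ m * ∫ x, G (fun j => Real.digits (x j) 2) ∂(uniformCube s)) ^ 2 ∂μ
      ≤ 2 ^ (t + s) * 2 ^ m * ∫ x, (G (fun j => Real.digits (x j) 2)
        - ∫ y, G (fun j => Real.digits (y j) 2) ∂(uniformCube s)) ^ 2 ∂(uniformCube s) := by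
  classical
  set c₀ := ∫ x, G (fun j => Real.digits (x j) 2) ∂(uniformCube s) with hc₀
  set D : Fin (2 ^ m) → Fin s → ℕ → Fin 2 := fun i j => Real.digits (P i j) 2 with hD
  let i₀ : Fin (2 ^ m) := ⟨0, by positivity⟩
  have hcyl : IsCylinder fun x => G x - c₀ := hG.comp₂ hG fun u _ => u - c₀
  have hcyl2 : IsCylinder fun x => (G x - c₀) ^ 2 := hG.comp₂ hG fun u _ => (u - c₀) ^ 2
  rw [← hcyl2.integral_scramble hπ (D i₀)]
  obtain ⟨S, c, hc⟩ := hcyl.exists_eq_sum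
  -- the constant term does not contribute
  have hmean : ∑ W ∈ S, c W * (if W = fun _ => none then 1 else 0) = (0 : ℝ) := by
    have h1 : ∫ ω, (G (scrambleArray (π ω) (D i₀)) - c₀) ∂μ = 0 := by
      rw [hcyl.integral_scramble hπ (D i₀)]
      have hGi : Integrable (fun x : Fin s → ℝ => G (fun j => Real.digits (x j) 2))
          (uniformCube s) := by
        obtain ⟨S, c, hc⟩ := hG.exists_eq_sum
        simp only [hc]
        refine integrable_finsetSum _ fun W _ => ?_
        exact (Integrable.of_bound ((measurable_tensorHaar W).comp
          measurable_digits_pi).aestronglyMeasurable 1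
          (ae_of_all _ fun _ => abs_tensorHaar_le_one _ _)).const_mul _
      rw [integral_sub hGi (integrable_const _)]
      simp [hc₀]
    simp only [hc] at h1
    rw [integral_finsetSum _ fun W _ =>
      (integrable_tensorHaar_scramble hπ (D i₀) W).const_mul _] at h1
    refine Eq.trans (Finset.sum_congr rfl fun W _ => ?_) h1
    rw [integral_const_mul]
    by_cases hW : W = fun _ => none
    · rw [hW, tensorHaar_none]; simp
    · rw [integral_tensorHaar_scramble_eq_zero hπ (D i₀) hW, if_neg hW]
  have hc' : ∀ x, G x - c₀ = ∑ W ∈ S.erase (fun _ => none), c W * tensorHaar W x := by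
    intro x
    rw [hc]
    by_cases hmem : (fun _ => none) ∈ S
    · rw [← Finset.sum_erase_add _ _ hmem]
      have : c (fun _ => none) = 0 := by simpa [hmem] using hmean
      rw [this]; simp
    · rw [Finset.erase_eq_of_notMem hmem]
  set T : (Fin s → Option (List (Fin 2))) → Ω → ℝ :=
    fun W ω => ∑ i, tensorHaar W (scrambleArray (π ω) (D i)) with hT
  have hv : ∀ W i, ∫ ω, tensorHaar W (scrambleArray (π ω) (D i)) ^ 2 ∂μ
      = ∫ ω, tensorHaar W (scrambleArray (π ω) (D i₀)) ^ 2 ∂μ := by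
    intro W i
    have : IsCylinder fun x => tensorHaar W x ^ 2 :=
      (isCylinder_tensorHaar W).comp₂ (isCylinder_tensorHaar W) fun u _ => u ^ 2
    rw [this.integral_scramble hπ, this.integral_scramble hπ]
  have hsum : ∀ ω, ∑ i, G (scrambleArray (π ω) (D i)) - 2 ^ m * c₀
      = ∑ W ∈ S.erase (fun _ => none), c W * T W ω := by
    intro ω
    have : ∑ i, G (scrambleArray (π ω) (D i)) - 2 ^ m * c₀
        = ∑ i, (G (scrambleArray (π ω) (D i)) - c₀) := by simp
    rw [this]
    simp only [hc', hT, Finset.mul_sum]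
    exact Finset.sum_comm
  have hTT : ∀ W W', ∫ ω, T W ω * T W' ω ∂μ = ∑ i, ∑ i',
      ∫ ω, tensorHaar W (scrambleArray (π ω) (D i))
        * tensorHaar W' (scrambleArray (π ω) (D i')) ∂μ := by
    intro W W'
    have hint : ∀ i i', Integrable (fun ω => tensorHaar W (scrambleArray (π ω) (D i))
        * tensorHaar W' (scrambleArray (π ω) (D i'))) μ := fun i i' =>
      (integrable_tensorHaar_scramble hπ (D i') W').bdd_mul
        (integrable_tensorHaar_scramble hπ (D i) W).aestronglyMeasurable
        (ae_of_all _ fun _ => abs_tensorHaar_le_one _ _)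
    simp only [hT, Finset.sum_mul_sum]
    rw [integral_finsetSum _ fun i _ => integrable_finsetSum _ fun i' _ => hint i i']
    exact Finset.sum_congr rfl fun i _ => integral_finsetSum _ fun i' _ => hint i i'
  have hTm : ∀ W, Measurable (T W) := fun W => Finset.measurable_sum _ fun i _ =>
    (measurable_tensorHaar W).comp (measurable_scrambleArray hπ (D i))
  have hTb : ∀ W ω, |T W ω| ≤ 2 ^ m := fun W ω => by
    refine (Finset.abs_sum_le_sum_abs _ _).trans
      ((Finset.sum_le_sum fun i _ => abs_tensorHaar_le_one _ _).trans ?_)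
    simp
  change ∫ ω, (∑ i, G (scrambleArray (π ω) (D i)) - 2 ^ m * c₀) ^ 2 ∂μ ≤ _
  simp only [hsum, hc']
  rw [integral_sq_sum_of_orthogonal _ T hTm _ hTb _ c, integral_sq_sum_of_orthogonal _
    (fun W ω => tensorHaar W (scrambleArray (π ω) (D i₀)))
    (fun W => (measurable_tensorHaar W).comp (measurable_scrambleArray hπ (D i₀))) 1
    (fun W ω => abs_tensorHaar_le_one _ _)
    (fun W W' h => integral_tensorHaar_mul_eq_zero hπ _ _ h) c, Finset.mul_sum]
  · refine Finset.sum_le_sum fun W hW => ?_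
    obtain ⟨j₀, hj₀⟩ := Function.ne_iff.1 (Finset.ne_of_mem_erase hW)
    set v := ∫ ω, tensorHaar W (scrambleArray (π ω) (D i₀)) ^ 2 ∂μ with hvdef
    have hv0 : 0 ≤ v := integral_nonneg fun _ => sq_nonneg _
    have h1 : ∫ ω, T W ω ^ 2 ∂μ ≤ 2 ^ (t + s) * 2 ^ m * v := by
      simp only [sq]
      rw [hTT]
      calc _ = ∑ i, (∑ i', ∏ j, pairGain (W j) (D i j) (D i' j)) * v := by
            refine Finset.sum_congr rfl fun i _ => ?_
            rw [Finset.sum_mul]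
            refine Finset.sum_congr rfl fun i' _ => ?_
            rw [integral_tensorHaar_mul_self hπ, hv]
        _ ≤ ∑ i : Fin (2 ^ m), 2 ^ (t + s) * v := by
            refine Finset.sum_le_sum fun i _ => mul_le_mul_of_nonneg_right ?_ hv0
            exact (le_abs_self _).trans (abs_sum_prod_pairGain_le hP W j₀ hj₀ i)
        _ = _ := by simp; ring
    calc _ ≤ c W ^ 2 * (2 ^ (t + s) * 2 ^ m * v) :=
          mul_le_mul_of_nonneg_left h1 (sq_nonneg _)
      _ = _ := by ring
  · intro W W' h
    rw [hTT]
    exact Finset.sum_eq_zero fun i _ => Finset.sum_eq_zero fun i' _ =>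
      integral_tensorHaar_mul_eq_zero hπ _ _ h

/-- The point of `[0,1]^s` with the given binary digits. -/
noncomputable def arrayPoint {s : ℕ} (z : Fin s → ℕ → Fin 2) : Fin s → ℝ :=
  fun j => Real.ofDigits (z j)

/-- Replace all the digits from position `L` on by `0`. -/
def truncateArray {s : ℕ} (L : ℕ) (z : Fin s → ℕ → Fin 2) : Fin s → ℕ → Fin 2 :=
  fun j l => if l < L then z j l else 0

lemma scramblePoint_eq {s : ℕ} (p : Fin s → List (Fin 2) → Equiv.Perm (Fin 2)) (x : Fin s → ℝ) :
    scramblePoint p x = arrayPoint (scrambleArray p fun j => Real.digits (x j) 2) := rfl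

lemma measurable_arrayPoint {s : ℕ} : Measurable (arrayPoint (s := s)) :=
  measurable_pi_iff.2 fun j => Real.continuous_ofDigits.measurable.comp (measurable_pi_apply j)

lemma measurable_truncateArray {s : ℕ} (L : ℕ) : Measurable (truncateArray (s := s) L) := by
  refine measurable_pi_iff.2 fun j => measurable_pi_iff.2 fun l => ?_
  unfold truncateArray
  split_ifs
  · exact (measurable_pi_apply (X := fun _ : ℕ => Fin 2) l).comp (measurable_pi_apply j)
  · exact measurable_const

lemma tendsto_arrayPoint_truncateArray {s : ℕ} (z : Fin s → ℕ → Fin 2) :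
    Tendsto (fun L => arrayPoint (truncateArray L z)) atTop (𝓝 (arrayPoint z)) := by
  refine tendsto_pi_nhds.2 fun j => (Real.continuous_ofDigits.tendsto (z j)).comp ?_
  refine tendsto_pi_nhds.2 fun l => tendsto_const_nhds.congr' ?_
  filter_upwards [eventually_gt_atTop l] with L hL
  simp [truncateArray, hL]

lemma isCylinder_truncateArray {s : ℕ} (L : ℕ) (F : (Fin s → ℕ → Fin 2) → ℝ) :
    IsCylinder fun z => F (truncateArray L z) := by
  refine ⟨L, fun x y h => ?_⟩
  have : truncateArray L x = truncateArray L y := by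
    funext j l
    simp only [truncateArray]
    split_ifs with hl
    · exact h j l hl
    · rfl
  simp only [this]

lemma ae_arrayPoint_digits (s : ℕ) :
    ∀ᵐ x ∂(uniformCube s), arrayPoint (fun j => Real.digits (x j) 2) = x := by
  have h : uniformCube s = volume.restrict (Set.univ.pi fun _ : Fin s => Set.Ico (0 : ℝ) 1) := by
    rw [uniformCube]
    exact Measure.restrict_congr_set Measure.pi_Ico_ae_eq_pi_Icc.symm
  rw [h]
  filter_upwards [ae_restrict_mem (MeasurableSet.univ_pi fun _ => measurableSet_Ico)] with x hx
  funext j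
  exact Real.ofDigits_digits one_lt_two (hx j trivial)

lemma tendsto_integral_truncateArray {Ω : Type*} [MeasurableSpace Ω] (ν : Measure Ω)
    [IsFiniteMeasure ν] {s : ℕ} {ι : Type*} (Z : ι → Ω → Fin s → ℕ → Fin 2)
    (hZ : ∀ i, Measurable (Z i)) (F : BoundedContinuousFunction (Fin s → ℝ) ℝ)
    (H : ℝ → (ι → ℝ) → ℝ) (hH : Continuous fun q : ℝ × (ι → ℝ) => H q.1 q.2) [Fintype ι]
    (c : ℕ → ℝ) (c₀ : ℝ) (hc : Tendsto c atTop (𝓝 c₀)) :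
    Tendsto (fun L => ∫ ω, H (c L) (fun i => F (arrayPoint (truncateArray L (Z i ω)))) ∂ν) atTop
      (𝓝 (∫ ω, H c₀ (fun i => F (arrayPoint (Z i ω))) ∂ν)) := by
  obtain ⟨R, hR⟩ := hc.bddAbove_range
  obtain ⟨R', hR'⟩ := hc.bddBelow_range
  have hK : IsCompact (Set.Icc R' R ×ˢ Metric.closedBall (0 : ι → ℝ) ‖F‖) :=
    isCompact_Icc.prod (isCompact_closedBall _ _)
  obtain ⟨M, hM⟩ := hK.exists_bound_of_continuousOn hH.continuousOn
  refine tendsto_integral_of_dominated_convergence (fun _ => M) (fun L => ?_) (integrable_const _)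
    (fun L => ae_of_all _ fun ω => ?_) (ae_of_all _ fun ω => ?_)
  · refine ((hH.comp (Continuous.prodMk_right (c L))).measurable.comp
      (measurable_pi_iff.2 fun i => ?_)).aestronglyMeasurable
    exact F.continuous.measurable.comp
      (measurable_arrayPoint.comp ((measurable_truncateArray L).comp (hZ i)))
  · refine hM (c L, _) ⟨⟨hR' ⟨L, rfl⟩, hR ⟨L, rfl⟩⟩, ?_⟩
    rw [mem_closedBall_zero_iff, pi_norm_le_iff_of_nonneg (norm_nonneg _)]
    exact fun i => F.norm_coe_le_norm _
  · refine (hH.tendsto (c₀, _)).comp (hc.prodMk_nhds (tendsto_pi_nhds.2 fun i => ?_))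
    exact (F.continuous.tendsto _).comp (tendsto_arrayPoint_truncateArray _)

lemma lpNorm_two_eq_sqrt {Ω : Type*} [MeasurableSpace Ω] {μ : Measure Ω} {F : Ω → ℝ}
    (hF : AEStronglyMeasurable F μ) :
    lpNorm F 2 μ = √(∫ x, F x ^ 2 ∂μ) := by
  rw [lpNorm_eq_integral_norm_rpow_toReal two_ne_zero ENNReal.ofNat_ne_top hF, Real.sqrt_eq_rpow]
  simp

section Net

variable {Ω : Type*} [MeasurableSpace Ω] {μ : Measure Ω} [IsProbabilityMeasure μ] {s t m : ℕ}

lemma measurePreserving_scramblePoint {π : Ω → Fin s → List (Fin 2) → Equiv.Perm (Fin 2)}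
    (hπ : IsUniformScrambling μ π) (x : Fin s → ℝ) :
    MeasurePreserving (fun ω => scramblePoint (π ω) x) μ (uniformCube s) := by
  have hm : Measurable fun ω => scramblePoint (π ω) x :=
    measurable_arrayPoint.comp (measurable_scrambleArray hπ _)
  refine ⟨hm, ?_⟩
  have : IsProbabilityMeasure (μ.map fun ω => scramblePoint (π ω) x) :=
    Measure.isProbabilityMeasure_map hm.aemeasurable
  refine ext_of_forall_integral_eq_of_IsFiniteMeasure fun F => ?_
  rw [integral_map hm.aemeasurable F.continuous.aestronglyMeasurable]
  have h1 := tendsto_integral_truncateArray μ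
    (fun (_ : Unit) ω => scrambleArray (π ω) fun j => Real.digits (x j) 2)
    (fun _ => measurable_scrambleArray hπ _) F (fun _ v => v ()) (by fun_prop) (fun _ => 0) 0
    tendsto_const_nhds
  have h2 := tendsto_integral_truncateArray (uniformCube s)
    (fun (_ : Unit) y j => Real.digits (y j) 2)
    (fun _ => measurable_digits_pi) F (fun _ v => v ()) (by fun_prop) (fun _ => 0) 0
    tendsto_const_nhds
  have h3 := fun L => (isCylinder_truncateArray L fun z => F (arrayPoint z)).integral_scramble hπ
    fun j => Real.digits (x j) 2
  simp only [h3] at h1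
  refine (tendsto_nhds_unique h1 h2).trans (integral_congr_ae ?_)
  filter_upwards [ae_arrayPoint_digits s] with y hy
  rw [hy]

lemma _root_.IsScrambledNet.measurePreserving {U : Ω → Fin (2 ^ m) → Fin s → ℝ}
    (hU : IsScrambledNet μ t m U) (i : Fin (2 ^ m)) :
    MeasurePreserving (fun ω => U ω i) μ (uniformCube s) := by
  obtain ⟨P, -, π, hπ, h⟩ := hU
  simp only [h]
  exact measurePreserving_scramblePoint hπ (P i)

lemma integral_sub_mean_sq_le {F : Ω → ℝ} (hF : MemLp F 2 μ) :
    ∫ x, (F x - ∫ y, F y ∂μ) ^ 2 ∂μ ≤ ∫ x, F x ^ 2 ∂μ := by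
  rw [← variance_eq_integral hF.aemeasurable]
  exact variance_le_expectation_sq hF.aestronglyMeasurable

lemma integral_sq_sum_sub_le_of_continuous {U : Ω → Fin (2 ^ m) → Fin s → ℝ}
    (hU : IsScrambledNet μ t m U) (F : BoundedContinuousFunction (Fin s → ℝ) ℝ) :
    ∫ ω, (∑ i, F (U ω i) - 2 ^ m * ∫ x, F x ∂(uniformCube s)) ^ 2 ∂μ
      ≤ 2 ^ (t + s) * 2 ^ m * ∫ x, (F x - ∫ y, F y ∂(uniformCube s)) ^ 2 ∂(uniformCube s) := by
  obtain ⟨P, hP, π, hπ, h⟩ := hU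
  have h2 := tendsto_integral_truncateArray (uniformCube s)
    (fun (_ : Unit) y j => Real.digits (y j) 2)
    (fun _ => measurable_digits_pi) F (fun _ v => v ()) (by fun_prop) (fun _ => 0) 0
    tendsto_const_nhds
  have hc : ∫ y, F (arrayPoint fun j => Real.digits (y j) 2) ∂(uniformCube s)
      = ∫ y, F y ∂(uniformCube s) := by
    refine integral_congr_ae ?_
    filter_upwards [ae_arrayPoint_digits s] with y hy
    rw [hy]
  rw [hc] at h2
  have h1 := tendsto_integral_truncateArray μ
    (fun i ω => scrambleArray (π ω) fun j => Real.digits (P i j) 2)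
    (fun _ => measurable_scrambleArray hπ _) F (fun c v => (∑ i, v i - 2 ^ m * c) ^ 2)
    (by fun_prop) _ _ h2
  have h3 := tendsto_integral_truncateArray (uniformCube s)
    (fun (_ : Unit) y j => Real.digits (y j) 2)
    (fun _ => measurable_digits_pi) F (fun c v => (v () - c) ^ 2) (by fun_prop) _ _ h2
  have h4 : ∫ y, (F (arrayPoint fun j => Real.digits (y j) 2) - ∫ y, F y ∂(uniformCube s)) ^ 2
      ∂(uniformCube s) = ∫ y, (F y - ∫ y, F y ∂(uniformCube s)) ^ 2 ∂(uniformCube s) := by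
    refine integral_congr_ae ?_
    filter_upwards [ae_arrayPoint_digits s] with y hy
    rw [hy]
  rw [h4] at h3
  simp only [h, scramblePoint_eq]
  refine le_of_tendsto_of_tendsto h1 (h3.const_mul (2 ^ (t + s) * 2 ^ m))
    (Eventually.of_forall fun L => ?_)
  exact (isCylinder_truncateArray L fun z => F (arrayPoint z)).integral_sq_sum_sub_le hπ hP

/-- Owen's variance bound for scrambled nets. -/
theorem _root_.IsScrambledNet.integral_sq_sum_sub_le {U : Ω → Fin (2 ^ m) → Fin s → ℝ}
    (hU : IsScrambledNet μ t m U) {F : (Fin s → ℝ) → ℝ} (hF : MemLp F 2 (uniformCube s)) :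
    ∫ ω, (∑ i, F (U ω i) - 2 ^ m * ∫ x, F x ∂(uniformCube s)) ^ 2 ∂μ
      ≤ 2 ^ (t + s) * 2 ^ m * ∫ x, (F x - ∫ y, F y ∂(uniformCube s)) ^ 2 ∂(uniformCube s) := by
  have hmp := hU.measurePreserving
  set lam := uniformCube s with hlam
  set T : ((Fin s → ℝ) → ℝ) → Ω → ℝ :=
    fun F ω => ∑ i, F (U ω i) - 2 ^ m * ∫ x, F x ∂lam with hT
  have hTmem : ∀ {H}, MemLp H 2 lam → MemLp (T H) 2 μ := fun {H} hH =>
    (memLp_finsetSum _ fun i _ => hH.comp_measurePreserving (hmp i)).sub (memLp_const _)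
  have hTcrude : ∀ {H}, MemLp H 2 lam → lpNorm (T H) 2 μ ≤ 2 ^ m * lpNorm H 2 lam := by
    intro H hH
    rw [lpNorm_two_eq_sqrt (hTmem hH).aestronglyMeasurable,
      lpNorm_two_eq_sqrt hH.aestronglyMeasurable]
    refine Real.sqrt_le_iff.2 ⟨by positivity, ?_⟩
    rw [mul_pow, Real.sq_sqrt (integral_nonneg fun _ => sq_nonneg _)]
    set c := ∫ x, H x ∂lam with hc
    have hmem : MemLp (fun x => H x - c) 2 lam := hH.sub (memLp_const c)
    have hint : ∀ i, Integrable (fun ω => (H (U ω i) - c) ^ 2) μ := fun i =>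
      (hmem.comp_measurePreserving (hmp i)).integrable_sq
    calc ∫ ω, T H ω ^ 2 ∂μ ≤ ∫ ω, 2 ^ m * ∑ i, (H (U ω i) - c) ^ 2 ∂μ := by
          refine integral_mono (hTmem hH).integrable_sq
            ((integrable_finsetSum _ fun i _ => hint i).const_mul _) fun ω => ?_
          have h1 : T H ω = ∑ i, (H (U ω i) - c) := by simp [hT, hc]
          have h2 := sq_sum_le_card_mul_sum_sq (s := Finset.univ) (f := fun i => H (U ω i) - c)
          simp only [h1]
          simpa using h2
      _ = 2 ^ m * ∑ i : Fin (2 ^ m), ∫ x, (H x - c) ^ 2 ∂lam := by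
          rw [integral_const_mul, integral_finsetSum _ fun i _ => hint i]
          congr 1
          refine Finset.sum_congr rfl fun i _ => ?_
          rw [← (hmp i).map_eq, integral_map (hmp i).measurable.aemeasurable]
          rw [(hmp i).map_eq]
          exact hmem.integrable_sq.aestronglyMeasurable
      _ ≤ (2 ^ m) ^ 2 * ∫ x, H x ^ 2 ∂lam := by
          simp only [Finset.sum_const, Finset.card_univ, Fintype.card_fin, nsmul_eq_mul]
          push_cast
          rw [← mul_assoc, ← sq]
          exact mul_le_mul_of_nonneg_left (integral_sub_mean_sq_le hH) (by positivity)
  have hTcont : ∀ H : BoundedContinuousFunction (Fin s → ℝ) ℝ, MemLp H 2 lam →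
      lpNorm (T H) 2 μ ≤ √(2 ^ (t + s) * 2 ^ m) * lpNorm H 2 lam := by
    intro H hH
    rw [lpNorm_two_eq_sqrt (hTmem hH).aestronglyMeasurable,
      lpNorm_two_eq_sqrt hH.aestronglyMeasurable, ← Real.sqrt_mul (by positivity)]
    refine Real.sqrt_le_sqrt ((integral_sq_sum_sub_le_of_continuous hU H).trans ?_)
    exact mul_le_mul_of_nonneg_left (integral_sub_mean_sq_le hH) (by positivity)
  have hTgen : ∀ {H}, MemLp H 2 lam →
      lpNorm (T H) 2 μ ≤ √(2 ^ (t + s) * 2 ^ m) * lpNorm H 2 lam := by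
    intro H hH
    set K := √(2 ^ (t + s) * 2 ^ m : ℝ) with hK
    have hK0 : 0 ≤ K := Real.sqrt_nonneg _
    refine le_of_forall_pos_le_add fun ε hε => ?_
    have hden : 0 < K + 2 ^ m := by positivity
    obtain ⟨G, hG, hGmem⟩ := hH.exists_boundedContinuous_eLpNorm_sub_le (ENNReal.ofNat_ne_top)
      (ε := ENNReal.ofReal (ε / (K + 2 ^ m))) (by simpa using div_pos hε hden)
    have hsub : lpNorm (H - ⇑G) 2 lam ≤ ε / (K + 2 ^ m) := by
      rw [← toReal_eLpNorm (hH.sub hGmem).aestronglyMeasurable]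
      exact ENNReal.toReal_le_of_le_ofReal (by positivity) hG
    have hadd : T H = T G + T (H - ⇑G) := by
      funext ω
      simp only [hT, Pi.add_apply, Pi.sub_apply, Finset.sum_sub_distrib]
      rw [integral_sub (hH.integrable one_le_two) (hGmem.integrable one_le_two)]
      ring
    have hGH : lpNorm G 2 lam ≤ lpNorm H 2 lam + lpNorm (H - ⇑G) 2 lam := by
      exact lpNorm_le_lpNorm_add_lpNorm_sub hH one_le_two
    calc lpNorm (T H) 2 μ ≤ lpNorm (T G) 2 μ + lpNorm (T (H - ⇑G)) 2 μ := by
          rw [hadd]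
          exact lpNorm_add_le (hTmem hGmem) one_le_two
      _ ≤ K * (lpNorm H 2 lam + lpNorm (H - ⇑G) 2 lam) + 2 ^ m * lpNorm (H - ⇑G) 2 lam :=
          add_le_add ((hTcont G hGmem).trans (mul_le_mul_of_nonneg_left hGH hK0))
            (hTcrude (hH.sub hGmem))
      _ = K * lpNorm H 2 lam + (K + 2 ^ m) * lpNorm (H - ⇑G) 2 lam := by ring
      _ ≤ K * lpNorm H 2 lam + (K + 2 ^ m) * (ε / (K + 2 ^ m)) := by gcongr
      _ = K * lpNorm H 2 lam + ε := by rw [mul_div_cancel₀ _ hden.ne']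
  set c := ∫ x, F x ∂lam with hc
  have hmem : MemLp (fun x => F x - c) 2 lam := hF.sub (memLp_const c)
  have hfin := hTgen hmem
  have hTF : T (fun x => F x - c) = T F := by
    funext ω
    simp only [hT]
    rw [integral_sub (hF.integrable one_le_two) (integrable_const _)]
    simp [← hc]
  rw [hTF, lpNorm_two_eq_sqrt (hTmem hF).aestronglyMeasurable,
    lpNorm_two_eq_sqrt hmem.aestronglyMeasurable, ← Real.sqrt_mul (by positivity)] at hfin
  exact (Real.sqrt_le_sqrt_iff
    (mul_nonneg (by positivity) (integral_nonneg fun _ => sq_nonneg _))).1 hfin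

end Net

end NestedScrambling

namespace IsKernel

variable {k : ℝ → ℝ}

lemma eq_abs (hk : IsKernel k) (x : ℝ) : k x = k |x| := by
  rcases abs_choice x with h | h <;> rw [h]
  exact (hk.symm x).symm

lemma le_of_abs_le (hk : IsKernel k) {x y : ℝ} (h : |x| ≤ |y|) : k y ≤ k x := by
  rw [hk.eq_abs x, hk.eq_abs y]
  exact hk.anti (abs_nonneg x) (abs_nonneg y) h

lemma le_zero (hk : IsKernel k) (x : ℝ) : k x ≤ k 0 := hk.le_of_abs_le (by simp)

lemma abs_le (hk : IsKernel k) (x : ℝ) : |k x| ≤ k 0 := by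
  rw [abs_of_nonneg (hk.nonneg x)]
  exact hk.le_zero x

lemma measurable (hk : IsKernel k) : Measurable k := by
  have h1 : Antitone fun y => k (max y 0) := fun x y hxy =>
    hk.anti (Set.mem_Ici.2 (le_max_right _ _)) (Set.mem_Ici.2 (le_max_right _ _))
      (max_le_max_right 0 hxy)
  have h2 : k = (fun y => k (max y 0)) ∘ fun x => |x| := by
    funext x
    simp [hk.eq_abs x]
  rw [h2]
  exact h1.measurable.comp measurable_abs

lemma integrable_sq (hk : IsKernel k) : Integrable fun x => k x ^ 2 := by
  simp only [sq]
  exact hk.integrable.bdd_mul hk.measurable.aestronglyMeasurable (ae_of_all _ hk.abs_le)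

/-- A unimodal kernel with finite second moment decays at least like `x ^ (-3)`. -/
lemma mul_cube_le (hk : IsKernel k) {u : ℝ} (hu : 0 < u) :
    k u * u ^ 3 ≤ 8 * ∫ x, x ^ 2 * k x := by
  have h1 : ∫ x in Set.Ioc (u / 2) u, (u / 2) ^ 2 * k u ≤ ∫ x in Set.Ioc (u / 2) u, x ^ 2 * k x := by
    refine setIntegral_mono_on (integrable_const _) hk.integrable_sq_mul.integrableOn
      measurableSet_Ioc fun x hx => ?_
    have hx0 : 0 < x := by linarith [hx.1]
    refine mul_le_mul ?_ (hk.anti hx0.le hu.le hx.2) (hk.nonneg u) (sq_nonneg x)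
    exact pow_le_pow_left₀ (by positivity) hx.1.le 2
  have h2 : ∫ x in Set.Ioc (u / 2) u, x ^ 2 * k x ≤ ∫ x, x ^ 2 * k x :=
    setIntegral_le_integral hk.integrable_sq_mul
      (ae_of_all _ fun x => mul_nonneg (sq_nonneg x) (hk.nonneg x))
  have h3 : ∫ x in Set.Ioc (u / 2) u, (u / 2) ^ 2 * k u = u / 2 * ((u / 2) ^ 2 * k u) := by
    rw [setIntegral_const, Real.volume_real_Ioc_of_le (by linarith), smul_eq_mul]
    ring
  rw [h3] at h1
  nlinarith

end IsKernel

namespace IsDensityOf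

variable {s : ℕ} {f : ℝ → ℝ} {g : (Fin s → ℝ) → ℝ}

lemma lintegral_eq_one (hf : IsDensityOf f g) (hg : Measurable g) :
    ∫⁻ x, ENNReal.ofReal (f x) = 1 := by
  have h := congrArg (fun ν => ν Set.univ) hf.law
  simp only [withDensity_apply _ MeasurableSet.univ, Measure.restrict_univ] at h
  rw [← h, Measure.map_apply hg MeasurableSet.univ]
  simp

lemma integrable (hf : IsDensityOf f g) (hg : Measurable g) : Integrable f := by
  refine ⟨hf.meas.aestronglyMeasurable, ?_⟩
  rw [hasFiniteIntegral_iff_ofReal (ae_of_all _ hf.nonneg), hf.lintegral_eq_one hg]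
  exact ENNReal.one_lt_top

lemma integral_eq_one (hf : IsDensityOf f g) (hg : Measurable g) : ∫ x, f x = 1 := by
  rw [integral_eq_lintegral_of_nonneg_ae (ae_of_all _ hf.nonneg) hf.meas.aestronglyMeasurable,
    hf.lintegral_eq_one hg, ENNReal.toReal_one]

lemma integral_comp (hf : IsDensityOf f g) (hg : Measurable g) {φ : ℝ → ℝ} (hφ : Measurable φ) :
    ∫ u, φ (g u) ∂(uniformCube s) = ∫ y, f y * φ y := by
  rw [← integral_map hg.aemeasurable hφ.aestronglyMeasurable, hf.law,
    integral_withDensity_eq_integral_toReal_smul hf.meas.ennreal_ofReal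
      (ae_of_all _ fun _ => ENNReal.ofReal_lt_top)]
  simp [ENNReal.toReal_ofReal (hf.nonneg _)]

end IsDensityOf

namespace IsSmoothDensityOn

variable {f : ℝ → ℝ} {a b : ℝ}

lemma _root_.TimesDifferentiableAt.eventually {r : ℕ} {x : ℝ}
    (h : TimesDifferentiableAt f (r + 1) x) : ∀ᶠ y in 𝓝 x, TimesDifferentiableAt f r y := h.1

lemma _root_.TimesDifferentiableAt.differentiableAt {r : ℕ} {x : ℝ}
    (h : TimesDifferentiableAt f (r + 1) x) : DifferentiableAt ℝ (iteratedDeriv r f) x := h.2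

/-- A uniform first order Taylor estimate near `[a,b]`. -/
lemma exists_taylor_bound (hs : IsSmoothDensityOn f a b) :
    ∃ δ > 0, ∃ M₀ M : ℝ, 0 ≤ M₀ ∧ 0 ≤ M ∧ ∀ x ∈ Set.Icc a b, |f x| ≤ M₀ ∧
      ∀ v, |v| < δ → |f (x - v) - f x + v * deriv f x| ≤ M * v ^ 2 := by
  set O := interior {x | TimesDifferentiableAt f 3 x} with hO
  have hO3 : ∀ x ∈ O, TimesDifferentiableAt f 3 x := fun x hx =>
    show x ∈ {x | TimesDifferentiableAt f 3 x} from interior_subset hx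
  have hsub : Set.Icc a b ⊆ O := fun x hx => mem_interior_iff_mem_nhds.2 (hs.diff x hx).eventually
  have h0 : ∀ x ∈ O, DifferentiableAt ℝ f x := fun x hx => by
    simpa using (hO3 x hx).eventually.self_of_nhds.eventually.self_of_nhds.differentiableAt
  have h1 : ∀ x ∈ O, HasDerivAt (deriv f) (iteratedDeriv 2 f x) x := fun x hx => by
    have := (hO3 x hx).eventually.self_of_nhds.differentiableAt.hasDerivAt
    rw [iteratedDeriv_succ]
    simpa only [iteratedDeriv_one] using this
  have h2 : ContinuousOn (iteratedDeriv 2 f) O := fun x hx =>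
    (hO3 x hx).differentiableAt.continuousAt.continuousWithinAt
  obtain ⟨δ, hδ, hthick⟩ := isCompact_Icc.exists_cthickening_subset_open isOpen_interior hsub
  obtain ⟨M₀, hM₀⟩ := isCompact_Icc.exists_bound_of_continuousOn
    fun x hx => (h0 x (hsub hx)).continuousAt.continuousWithinAt
  obtain ⟨M, hM⟩ := (isCompact_Icc (a := a) (b := b)).cthickening (r := δ)
    |>.exists_bound_of_continuousOn (h2.mono hthick)
  refine ⟨δ, hδ, |M₀|, |M|, abs_nonneg _, abs_nonneg _, fun x hx => ⟨?_, fun v hv => ?_⟩⟩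
  · exact (hM₀ x hx).trans (le_abs_self _)
  have hball : ∀ y ∈ Metric.closedBall x |v|, y ∈ Metric.cthickening δ (Set.Icc a b) := by
    intro y hy
    exact Metric.mem_cthickening_of_dist_le y x δ _ hx ((Metric.mem_closedBall.1 hy).trans hv.le)
  have hx0 : x ∈ Metric.closedBall x |v| := Metric.mem_closedBall_self (abs_nonneg v)
  have hlip : ∀ y ∈ Metric.closedBall x |v|, ‖deriv f y - deriv f x‖ ≤ |M| * |v| := by
    intro y hy
    refine ((convex_closedBall x |v|).norm_image_sub_le_of_norm_hasDerivWithin_le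
      (fun z hz => (h1 z (hthick (hball z hz))).hasDerivWithinAt)
      (fun z hz => (hM z (hball z hz)).trans (le_abs_self M)) hx0 hy).trans ?_
    exact mul_le_mul_of_nonneg_left (by simpa [dist_eq_norm] using hy) (abs_nonneg M)
  have hv' : x - v ∈ Metric.closedBall x |v| := by simp
  have := (convex_closedBall x |v|).norm_image_sub_le_of_norm_hasDerivWithin_le
    (f := fun y => f y - deriv f x * y) (f' := fun y => deriv f y - deriv f x)
    (fun z hz => ((h0 z (hthick (hball z hz))).hasDerivAt.sub
      (by simpa using (hasDerivAt_id z).const_mul (deriv f x))).hasDerivWithinAt)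
    hlip hx0 hv'
  calc |f (x - v) - f x + v * deriv f x|
      = ‖f (x - v) - deriv f x * (x - v) - (f x - deriv f x * x)‖ := by
        rw [Real.norm_eq_abs]; congr 1; ring
    _ ≤ |M| * |v| * ‖x - v - x‖ := this
    _ = |M| * v ^ 2 := by
        rw [sub_sub_cancel_left, norm_neg, Real.norm_eq_abs, mul_assoc, ← sq, sq_abs]

end IsSmoothDensityOn

/-- The bias of a kernel density estimator is of the order of the square of the bandwidth,
uniformly on `[a,b]`. -/
lemma exists_bias_bound {s : ℕ} {f : ℝ → ℝ} {g : (Fin s → ℝ) → ℝ} {k : ℝ → ℝ} {a b : ℝ}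
    (hg : Measurable g) (hf : IsDensityOf f g) (hk : IsKernel k) (hs : IsSmoothDensityOn f a b) :
    ∃ C : ℝ, ∀ h > 0, ∀ x ∈ Set.Icc a b,
      |(∫ u, k ((x - g u) / h) ∂(uniformCube s)) / h - f x| ≤ C * h ^ 2 := by
  obtain ⟨δ, hδ, M₀, M, hM₀, hM, hT⟩ := hs.exists_taylor_bound
  set μ₂ := ∫ x, x ^ 2 * k x with hμ₂
  refine ⟨M * μ₂ + 8 * μ₂ / δ ^ 3 + M₀ / δ ^ 2 * μ₂, fun h hh x hx => ?_⟩
  obtain ⟨hfx, hTx⟩ := hT x hx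
  set kh : ℝ → ℝ := fun v => k (v / h) / h with hkh
  have hkh0 : ∀ v, 0 ≤ kh v := fun v => div_nonneg (hk.nonneg _) hh.le
  have hkhm : Measurable kh := (hk.measurable.comp (measurable_id.div_const h)).div_const h
  have hkhb : ∀ v, ‖kh v‖ ≤ k 0 / h := fun v => by
    rw [Real.norm_eq_abs, abs_of_nonneg (hkh0 v)]
    exact div_le_div_of_nonneg_right (hk.le_zero _) hh.le
  have hkhi : Integrable kh := (hk.integrable.comp_div hh.ne').div_const h
  have hkh1 : ∫ v, kh v = 1 := by
    rw [integral_div, Measure.integral_comp_div, hk.integral_eq_one, abs_of_pos hh]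
    simp [hh.ne']
  have hkh2e : (fun v => v ^ 2 * kh v) = fun v => h * ((v / h) ^ 2 * k (v / h)) := by
    funext v
    simp only [hkh]
    field_simp
  have hkh2i : Integrable fun v => v ^ 2 * kh v := by
    rw [hkh2e]
    exact (hk.integrable_sq_mul.comp_div hh.ne').const_mul h
  have hkh2 : ∫ v, v ^ 2 * kh v = h ^ 2 * μ₂ := by
    rw [hkh2e, integral_const_mul, Measure.integral_comp_div (fun v => v ^ 2 * k v),
      abs_of_pos hh, smul_eq_mul]
    ring
  have hfxi : Integrable fun v => f (x - v) := (hf.integrable hg).comp_sub_left x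
  have hprod : Integrable fun v => kh v * f (x - v) :=
    hfxi.bdd_mul hkhm.aestronglyMeasurable (ae_of_all _ hkhb)
  set odd : ℝ → ℝ := fun v => if |v| < δ then v * kh v else 0 with hodd
  have hoddm : Measurable odd := Measurable.ite (measurableSet_lt measurable_abs measurable_const)
    (measurable_id.mul hkhm) measurable_const
  have hoddi : Integrable odd := by
    refine (hkhi.const_mul δ).mono' hoddm.aestronglyMeasurable (ae_of_all _ fun v => ?_)
    simp only [hodd]
    split_ifs with hv
    · rw [Real.norm_eq_abs, abs_mul, abs_of_nonneg (hkh0 v)]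
      exact mul_le_mul_of_nonneg_right hv.le (hkh0 v)
    · simpa using mul_nonneg hδ.le (hkh0 v)
  have hodd0 : ∫ v, odd v = 0 := by
    have h1 : ∀ v, odd (-v) = - odd v := by
      intro v
      simp only [hodd, hkh, abs_neg, neg_div, hk.symm]
      split_ifs <;> simp
    have h2 := integral_neg_eq_self odd volume
    simp only [h1, integral_neg] at h2
    linarith
  have hmean : (∫ u, k ((x - g u) / h) ∂(uniformCube s)) / h = ∫ v, kh v * f (x - v) := by
    rw [hf.integral_comp hg (φ := fun y => k ((x - y) / h))
      (hk.measurable.comp ((measurable_const.sub measurable_id).div_const h)), ← integral_div,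
      ← integral_sub_left_eq_self (fun v => kh v * f (x - v)) volume x]
    congr 1
    funext y
    simp only [hkh, sub_sub_cancel]
    ring
  have hbias : (∫ u, k ((x - g u) / h) ∂(uniformCube s)) / h - f x
      = ∫ v, (kh v * f (x - v) - kh v * f x + odd v * deriv f x) := by
    have hdiff : Integrable fun v => kh v * f (x - v) - kh v * f x := hprod.sub (hkhi.mul_const _)
    rw [integral_add hdiff (hoddi.mul_const _),
      integral_sub hprod (hkhi.mul_const _), integral_mul_const, integral_mul_const, hodd0, hkh1,
      hmean]
    ring
  have hdecay : ∀ v, δ ≤ |v| → kh v ≤ 8 * μ₂ / δ ^ 3 * h ^ 2 := by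
    intro v hv
    have h1 : k (v / h) ≤ k (δ / h) := hk.le_of_abs_le (by
      rw [abs_div, abs_div, abs_of_pos hδ]; gcongr)
    have h2 := hk.mul_cube_le (div_pos hδ hh)
    calc kh v ≤ k (δ / h) / h := div_le_div_of_nonneg_right h1 hh.le
      _ = k (δ / h) * (δ / h) ^ 3 * (h ^ 2 / δ ^ 3) := by field_simp
      _ ≤ 8 * μ₂ * (h ^ 2 / δ ^ 3) := mul_le_mul_of_nonneg_right h2 (by positivity)
      _ = _ := by ring
  have hμ₂0 : 0 < μ₂ := hk.second_moment_pos
  rw [hbias, ← Real.norm_eq_abs]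
  refine (norm_integral_le_of_norm_le (((hkh2i.const_mul M).add
    (hfxi.const_mul (8 * μ₂ / δ ^ 3 * h ^ 2))).add (hkh2i.const_mul (M₀ / δ ^ 2)))
    (ae_of_all _ fun v => ?_)).trans (le_of_eq ?_)
  · simp only [Pi.add_apply, Real.norm_eq_abs]
    have hfv := hf.nonneg (x - v)
    have hkv := hkh0 v
    by_cases hv : |v| < δ
    · have e : kh v * f (x - v) - kh v * f x + odd v * deriv f x
          = kh v * (f (x - v) - f x + v * deriv f x) := by
        simp only [hodd, if_pos hv]; ring
      rw [e, abs_mul, abs_of_nonneg hkv]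
      have := mul_le_mul_of_nonneg_left (hTx v hv) hkv
      have p1 : 0 ≤ 8 * μ₂ / δ ^ 3 * h ^ 2 * f (x - v) := by positivity
      have p2 : 0 ≤ M₀ / δ ^ 2 * (v ^ 2 * kh v) := by positivity
      linarith
    · have hv' : δ ≤ |v| := not_lt.1 hv
      have e : kh v * f (x - v) - kh v * f x + odd v * deriv f x
          = kh v * f (x - v) - kh v * f x := by
        simp only [hodd, if_neg hv]; ring
      rw [e]
      have q1 : kh v * f (x - v) ≤ 8 * μ₂ / δ ^ 3 * h ^ 2 * f (x - v) :=
        mul_le_mul_of_nonneg_right (hdecay v hv') hfv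
      have q2 : |kh v * f x| ≤ M₀ / δ ^ 2 * (v ^ 2 * kh v) := by
        rw [abs_mul, abs_of_nonneg hkv]
        have r1 : 1 ≤ v ^ 2 / δ ^ 2 := by
          rw [one_le_div (by positivity), ← sq_abs v]
          exact pow_le_pow_left₀ hδ.le hv' 2
        calc kh v * |f x| ≤ kh v * M₀ := mul_le_mul_of_nonneg_left hfx hkv
          _ = kh v * M₀ * 1 := by ring
          _ ≤ kh v * M₀ * (v ^ 2 / δ ^ 2) := mul_le_mul_of_nonneg_left r1 (by positivity)
          _ = _ := by ring
      have p1 : 0 ≤ M * (v ^ 2 * kh v) := by positivity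
      have q3 := abs_sub (kh v * f (x - v)) (kh v * f x)
      rw [abs_of_nonneg (mul_nonneg hkv hfv)] at q3
      linarith
  · rw [integral_add' ((hkh2i.const_mul M).add (hfxi.const_mul _)) (hkh2i.const_mul _),
      integral_add' (hkh2i.const_mul M) (hfxi.const_mul _), integral_const_mul, integral_const_mul,
      integral_const_mul, hkh2, integral_sub_left_eq_self f volume x, hf.integral_eq_one hg]
    ring

lemma MeasureTheory.MeasurePreserving.integral_comp_of_aestronglyMeasurable {α β : Type*}
    [MeasurableSpace α] [MeasurableSpace β] {μ : Measure α} {ν : Measure β} {φ : α → β}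
    (h : MeasurePreserving φ μ ν) {G : β → ℝ} (hG : AEStronglyMeasurable G ν) :
    ∫ x, G (φ x) ∂μ = ∫ y, G y ∂ν := by
  have hG' : AEStronglyMeasurable G (μ.map φ) := by rwa [h.map_eq]
  rw [← h.map_eq, integral_map h.measurable.aemeasurable hG']

namespace NestedScrambling

lemma _root_.IsMonteCarlo.measurePreserving {Ω : Type*} [MeasurableSpace Ω] {μ : Measure Ω}
    {N s : ℕ} {V : Ω → Fin N → Fin s → ℝ} (hV : IsMonteCarlo μ V) (i : Fin N) :
    MeasurePreserving (fun ω => V ω i) μ (uniformCube s) :=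
  ⟨hV.meas i, hV.unif i⟩

lemma _root_.IsMonteCarlo.integral_sq_sum_sub {Ω : Type*} [MeasurableSpace Ω] {μ : Measure Ω}
    [IsProbabilityMeasure μ] {N s : ℕ} {V : Ω → Fin N → Fin s → ℝ} (hV : IsMonteCarlo μ V)
    {F : (Fin s → ℝ) → ℝ} (hFm : Measurable F) (hF : MemLp F 2 (uniformCube s)) :
    ∫ ω, (∑ i, F (V ω i) - N * ∫ x, F x ∂(uniformCube s)) ^ 2 ∂μ
      = N * ∫ x, (F x - ∫ y, F y ∂(uniformCube s)) ^ 2 ∂(uniformCube s) := by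
  have hmp := hV.measurePreserving
  have hmem : ∀ i, MemLp (fun ω => F (V ω i)) 2 μ := fun i => hF.comp_measurePreserving (hmp i)
  have hmean : ∀ i, ∫ ω, F (V ω i) ∂μ = ∫ x, F x ∂(uniformCube s) := fun i =>
    (hmp i).integral_comp_of_aestronglyMeasurable hFm.aestronglyMeasurable
  have hvar := IndepFun.variance_sum (μ := μ) (X := fun i ω => F (V ω i)) (s := Finset.univ)
    (fun i _ => hmem i) fun i _ j _ hij => (hV.indep.indepFun hij).comp hFm hFm
  have hsum : (∑ i, fun ω => F (V ω i)) = fun ω => ∑ i, F (V ω i) := by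
    funext ω; simp
  rw [hsum, variance_eq_integral (memLp_finsetSum _ fun i _ => hmem i).aemeasurable,
    integral_finsetSum _ fun i _ => (hmem i).integrable one_le_two] at hvar
  simp only [hmean, Finset.sum_const, Finset.card_univ, Fintype.card_fin, nsmul_eq_mul] at hvar
  rw [hvar]
  have : ∀ i, variance (fun ω => F (V ω i)) μ
      = ∫ x, (F x - ∫ y, F y ∂(uniformCube s)) ^ 2 ∂(uniformCube s) := by
    intro i
    rw [variance_eq_integral (hmem i).aemeasurable, hmean]
    exact (hmp i).integral_comp_of_aestronglyMeasurable
      (G := fun x => (F x - ∫ y, F y ∂(uniformCube s)) ^ 2)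
      ((hFm.sub_const _).pow_const 2).aestronglyMeasurable
  simp [this]

/-! ### Moments of the kernel at a uniform point -/

section Kernel

variable {s : ℕ} {g : (Fin s → ℝ) → ℝ} {k : ℝ → ℝ}

/-- The mean of `k ((x - g U) / h)` for `U` uniform. -/
noncomputable def kernelMean (g : (Fin s → ℝ) → ℝ) (k : ℝ → ℝ) (h x : ℝ) : ℝ :=
  ∫ u, k ((x - g u) / h) ∂(uniformCube s)

/-- The second moment of `k ((x - g U) / h)` for `U` uniform. -/
noncomputable def kernelSecondMoment (g : (Fin s → ℝ) → ℝ) (k : ℝ → ℝ) (h x : ℝ) : ℝ :=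
  ∫ u, k ((x - g u) / h) ^ 2 ∂(uniformCube s)

/-- The variance of `k ((x - g U) / h)` for `U` uniform. -/
noncomputable def kernelVariance (g : (Fin s → ℝ) → ℝ) (k : ℝ → ℝ) (h x : ℝ) : ℝ :=
  ∫ u, (k ((x - g u) / h) - kernelMean g k h x) ^ 2 ∂(uniformCube s)

lemma measurable_kernel_uncurry (hk : IsKernel k) (hg : Measurable g) (h : ℝ) :
    Measurable fun q : ℝ × (Fin s → ℝ) => k ((q.1 - g q.2) / h) :=
  hk.measurable.comp ((measurable_fst.sub (hg.comp measurable_snd)).div_const h)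

lemma measurable_kernel (hk : IsKernel k) (hg : Measurable g) (h x : ℝ) :
    Measurable fun u => k ((x - g u) / h) :=
  hk.measurable.comp ((measurable_const.sub hg).div_const h)

lemma memLp_kernel (hk : IsKernel k) (hg : Measurable g) (h x : ℝ) :
    MemLp (fun u => k ((x - g u) / h)) 2 (uniformCube s) :=
  MemLp.of_bound (measurable_kernel hk hg h x).aestronglyMeasurable (k 0)
    (ae_of_all _ fun _ => hk.abs_le _)

lemma kernelVariance_nonneg (h x : ℝ) : 0 ≤ kernelVariance g k h x :=
  integral_nonneg fun _ => sq_nonneg _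

lemma kernelVariance_le (hk : IsKernel k) (hg : Measurable g) (h x : ℝ) :
    kernelVariance g k h x ≤ kernelSecondMoment g k h x :=
  integral_sub_mean_sq_le (memLp_kernel hk hg h x)

lemma kernelVariance_eq (hk : IsKernel k) (hg : Measurable g) (h x : ℝ) :
    kernelVariance g k h x = kernelSecondMoment g k h x - kernelMean g k h x ^ 2 := by
  have h1 := variance_eq_sub (memLp_kernel hk hg h x)
  rw [variance_eq_integral (measurable_kernel hk hg h x).aemeasurable] at h1
  exact h1

lemma measurable_kernelMean (hk : IsKernel k) (hg : Measurable g) (h : ℝ) :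
    Measurable (kernelMean g k h) :=
  ((measurable_kernel_uncurry hk hg h).stronglyMeasurable.integral_prod_right'
    (ν := uniformCube s)).measurable

lemma integrable_kernel_sq (hk : IsKernel k) (hg : Measurable g) {h : ℝ} (hh : 0 < h) :
    Integrable (fun q : ℝ × (Fin s → ℝ) => k ((q.1 - g q.2) / h) ^ 2)
      (volume.prod (uniformCube s)) := by
  rw [integrable_prod_iff' ((measurable_kernel_uncurry hk hg h).pow_const 2).aestronglyMeasurable]
  refine ⟨ae_of_all _ fun u => (hk.integrable_sq.comp_div hh.ne').comp_sub_right (g u), ?_⟩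
  have : ∀ u : Fin s → ℝ, ∫ x, ‖k ((x - g u) / h) ^ 2‖ = h * ∫ x, k x ^ 2 := by
    intro u
    simp only [norm_pow, Real.norm_eq_abs, sq_abs]
    rw [integral_sub_right_eq_self (fun x => k (x / h) ^ 2) (g u),
      Measure.integral_comp_div (fun x => k x ^ 2), abs_of_pos hh, smul_eq_mul]
  simp only [this]
  exact integrable_const _

lemma integrable_kernelSecondMoment (hk : IsKernel k) (hg : Measurable g) {h : ℝ} (hh : 0 < h) :
    Integrable (kernelSecondMoment g k h) :=
  (integrable_kernel_sq hk hg hh).integral_prod_left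

lemma integral_kernelSecondMoment (hk : IsKernel k) (hg : Measurable g) {h : ℝ} (hh : 0 < h) :
    ∫ x, kernelSecondMoment g k h x = h * ∫ x, k x ^ 2 := by
  have h1 := integral_integral_swap (f := fun x u => k ((x - g u) / h) ^ 2)
    (integrable_kernel_sq hk hg hh)
  have : ∀ u : Fin s → ℝ, ∫ x, k ((x - g u) / h) ^ 2 = h * ∫ x, k x ^ 2 := by
    intro u
    rw [integral_sub_right_eq_self (fun x => k (x / h) ^ 2) (g u),
      Measure.integral_comp_div (fun x => k x ^ 2), abs_of_pos hh, smul_eq_mul]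
  simp only [this] at h1
  simpa [kernelSecondMoment] using h1

lemma integrable_kernelVariance (hk : IsKernel k) (hg : Measurable g) {h : ℝ} (hh : 0 < h) :
    Integrable (kernelVariance g k h) := by
  refine (integrable_kernelSecondMoment hk hg hh).mono' ?_ (ae_of_all _ fun x => ?_)
  · rw [funext (kernelVariance_eq hk hg h)]
    exact (integrable_kernelSecondMoment hk hg hh).aestronglyMeasurable.sub
      ((measurable_kernelMean hk hg h).pow_const 2).aestronglyMeasurable
  · rw [Real.norm_eq_abs, abs_of_nonneg (kernelVariance_nonneg h x)]
    exact kernelVariance_le hk hg h x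

/-- Over any interval, the kernel variances integrate to at most `h * ∫ k ^ 2`. -/
lemma intervalIntegral_kernelVariance_le (hk : IsKernel k) (hg : Measurable g) {h : ℝ}
    (hh : 0 < h) {a b : ℝ} (hab : a ≤ b) :
    ∫ x in a..b, kernelVariance g k h x ≤ h * ∫ x, k x ^ 2 := by
  rw [← integral_kernelSecondMoment hk hg hh, intervalIntegral.integral_of_le hab]
  have h0 : ∀ x, 0 ≤ kernelSecondMoment g k h x := fun x =>
    (kernelVariance_nonneg h x).trans (kernelVariance_le hk hg h x)
  exact (setIntegral_mono (integrable_kernelVariance hk hg hh).integrableOn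
    (integrable_kernelSecondMoment hk hg hh).integrableOn (kernelVariance_le hk hg h)).trans
    (setIntegral_le_integral (integrable_kernelSecondMoment hk hg hh) (ae_of_all _ h0))

variable {Ω : Type*} [MeasurableSpace Ω] {μ : Measure Ω} [IsProbabilityMeasure μ] {N : ℕ}
  {U : Ω → Fin N → Fin s → ℝ}

lemma integral_kde (hk : IsKernel k) (hg : Measurable g) (hN : N ≠ 0)
    (hU : ∀ i, MeasurePreserving (fun ω => U ω i) μ (uniformCube s)) (h x : ℝ) :
    ∫ ω, kde k h (fun i => g (U ω i)) x ∂μ = kernelMean g k h x / h := by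
  have hint : ∀ i, Integrable (fun ω => k ((x - g (U ω i)) / h)) μ := fun i =>
    ((memLp_kernel hk hg h x).comp_measurePreserving (hU i)).integrable one_le_two
  have hmean : ∀ i, ∫ ω, k ((x - g (U ω i)) / h) ∂μ = kernelMean g k h x := fun i =>
    (hU i).integral_comp_of_aestronglyMeasurable
      (measurable_kernel hk hg h x).aestronglyMeasurable
  simp only [kde]
  rw [integral_const_mul, integral_finsetSum _ fun i _ => hint i]
  have hN' : (N : ℝ) ≠ 0 := Nat.cast_ne_zero.2 hN
  simp only [hmean, Finset.sum_const, Finset.card_univ, Fintype.card_fin, nsmul_eq_mul]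
  field_simp

/-- Bias-variance decomposition. -/
lemma integral_kde_sub_sq (hk : IsKernel k) (hg : Measurable g) (hN : N ≠ 0)
    (hU : ∀ i, MeasurePreserving (fun ω => U ω i) μ (uniformCube s)) (h x y : ℝ) :
    ∫ ω, (kde k h (fun i => g (U ω i)) x - y) ^ 2 ∂μ
      = (1 / (N * h)) ^ 2
          * ∫ ω, (∑ i, k ((x - g (U ω i)) / h) - N * kernelMean g k h x) ^ 2 ∂μ
        + (kernelMean g k h x / h - y) ^ 2 := by
  have hmem : ∀ i, MemLp (fun ω => k ((x - g (U ω i)) / h)) 2 μ := fun i =>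
    (memLp_kernel hk hg h x).comp_measurePreserving (hU i)
  have hkde : MemLp (fun ω => kde k h (fun i => g (U ω i)) x) 2 μ := by
    simp only [kde]
    exact (memLp_finsetSum _ fun i _ => hmem i).const_mul _
  set m := kernelMean g k h x / h with hm
  have hmean : ∫ ω, kde k h (fun i => g (U ω i)) x ∂μ = m := integral_kde hk hg hN hU h x
  have hN' : (N : ℝ) ≠ 0 := Nat.cast_ne_zero.2 hN
  have h1 : ∀ ω, (1 / (N * h)) ^ 2
      * (∑ i, k ((x - g (U ω i)) / h) - N * kernelMean g k h x) ^ 2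
      = (kde k h (fun i => g (U ω i)) x - m) ^ 2 := by
    intro ω
    rw [← mul_pow, kde, hm]
    congr 1
    rw [mul_sub]
    congr 1
    field_simp
  rw [← integral_const_mul]
  simp only [h1]
  have hc : MemLp (fun ω => kde k h (fun i => g (U ω i)) x - m) 2 μ := hkde.sub (memLp_const m)
  have h2 : ∀ ω, (kde k h (fun i => g (U ω i)) x - y) ^ 2
      = (kde k h (fun i => g (U ω i)) x - m) ^ 2
        + (2 * (m - y) * (kde k h (fun i => g (U ω i)) x - m) + (m - y) ^ 2) := fun ω => by ring
  have hi : Integrable (fun ω => 2 * (m - y) * (kde k h (fun i => g (U ω i)) x - m)) μ :=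
    (hc.integrable one_le_two).const_mul _
  have hi' : Integrable (fun ω => 2 * (m - y) * (kde k h (fun i => g (U ω i)) x - m)
      + (m - y) ^ 2) μ := hi.add (integrable_const _)
  simp only [h2]
  rw [integral_add hc.integrable_sq hi',
    integral_add hi (integrable_const _), integral_const_mul,
    integral_sub (hkde.integrable one_le_two) (integrable_const _), hmean]
  simp

lemma integral_kde_sub_sq_le_of_net {t m : ℕ} (hk : IsKernel k) (hg : Measurable g)
    {U : Ω → Fin (2 ^ m) → Fin s → ℝ} (hU : IsScrambledNet μ t m U) {h : ℝ} (hh : 0 < h)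
    (x y : ℝ) :
    ∫ ω, (kde k h (fun i => g (U ω i)) x - y) ^ 2 ∂μ
      ≤ 2 ^ (t + s) / (2 ^ m * h ^ 2) * kernelVariance g k h x
        + (kernelMean g k h x / h - y) ^ 2 := by
  rw [integral_kde_sub_sq hk hg (by positivity) hU.measurePreserving]
  refine add_le_add_left ?_ _
  push_cast
  refine (mul_le_mul_of_nonneg_left (hU.integral_sq_sum_sub_le (memLp_kernel hk hg h x))
    (sq_nonneg _)).trans (le_of_eq ?_)
  rw [kernelVariance, kernelMean]
  field_simp

lemma integral_kde_sub_sq_of_monteCarlo (hk : IsKernel k) (hg : Measurable g) (hN : N ≠ 0)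
    (hU : IsMonteCarlo μ U) {h : ℝ} (hh : 0 < h) (x y : ℝ) :
    ∫ ω, (kde k h (fun i => g (U ω i)) x - y) ^ 2 ∂μ
      = 1 / (N * h ^ 2) * kernelVariance g k h x + (kernelMean g k h x / h - y) ^ 2 := by
  have hN' : (N : ℝ) ≠ 0 := Nat.cast_ne_zero.2 hN
  rw [integral_kde_sub_sq hk hg hN hU.measurePreserving, kernelMean,
    hU.integral_sq_sum_sub (measurable_kernel hk hg h x) (memLp_kernel hk hg h x)]
  congr 1
  rw [kernelVariance, kernelMean]
  field_simp

lemma two_pow_add_le (t s : ℕ) : (2 : ℝ) ^ (t + s) ≤ 2 ^ t * 3 ^ s := by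
  rw [pow_add]
  gcongr
  norm_num

lemma integratedVariance_le {t m : ℕ} (hk : IsKernel k) (hg : Measurable g)
    {U : Ω → Fin (2 ^ m) → Fin s → ℝ} (hU : IsScrambledNet μ t m U) {h : ℝ} (hh : 0 < h)
    {a b : ℝ} (hab : a ≤ b) :
    integratedVariance μ U g k h a b ≤ 2 ^ t * 3 ^ s * (∫ x, k x ^ 2) / (2 ^ m * h) := by
  have hmean := integral_kde hk hg (by positivity) hU.measurePreserving h
  have hk2 : 0 ≤ ∫ x, k x ^ 2 := integral_nonneg fun _ => sq_nonneg _
  rw [integratedVariance, intervalIntegral.integral_of_le hab]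
  calc _ ≤ ∫ x in Set.Ioc a b, 2 ^ (t + s) / (2 ^ m * h ^ 2) * kernelVariance g k h x := by
        refine integral_mono_of_nonneg
          (ae_of_all _ fun x => integral_nonneg fun _ => sq_nonneg _)
          ((integrable_kernelVariance hk hg hh).const_mul _).integrableOn
          (ae_of_all _ fun x => ?_)
        have := integral_kde_sub_sq_le_of_net hk hg hU hh x (kernelMean g k h x / h)
        simpa [hmean] using this
    _ ≤ 2 ^ (t + s) / (2 ^ m * h ^ 2) * (h * ∫ x, k x ^ 2) := by
        rw [integral_const_mul, ← intervalIntegral.integral_of_le hab]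
        exact mul_le_mul_of_nonneg_left (intervalIntegral_kernelVariance_le hk hg hh hab)
          (by positivity)
    _ = 2 ^ (t + s) * (∫ x, k x ^ 2) / (2 ^ m * h) := by field_simp
    _ ≤ _ := by
        gcongr
        exact two_pow_add_le t s

/-- Mean integrated square error of a scrambled net when the bias is of second order. -/
lemma mise_le {t m : ℕ} (hk : IsKernel k) (hg : Measurable g) {f : ℝ → ℝ}
    {U : Ω → Fin (2 ^ m) → Fin s → ℝ} (hU : IsScrambledNet μ t m U) {h : ℝ} (hh : 0 < h)
    {a b C : ℝ} (hab : a ≤ b)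
    (hC : ∀ x ∈ Set.Icc a b, |kernelMean g k h x / h - f x| ≤ C * h ^ 2) :
    mise μ U g f k h a b
      ≤ 2 ^ t * 3 ^ s * (∫ x, k x ^ 2) / (2 ^ m * h) + (b - a) * (C ^ 2 * h ^ 4) := by
  have hk2 : 0 ≤ ∫ x, k x ^ 2 := integral_nonneg fun _ => sq_nonneg _
  have hint := ((integrable_kernelVariance (g := g) hk hg hh).const_mul
    (2 ^ (t + s) / (2 ^ m * h ^ 2))).integrableOn (s := Set.Ioc a b)
  rw [mise, intervalIntegral.integral_of_le hab]
  calc _ ≤ ∫ x in Set.Ioc a b,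
          (2 ^ (t + s) / (2 ^ m * h ^ 2) * kernelVariance g k h x + C ^ 2 * h ^ 4) := by
        refine integral_mono_of_nonneg
          (ae_of_all _ fun x => integral_nonneg fun _ => sq_nonneg _)
          (hint.add (integrable_const _)) ?_
        filter_upwards [ae_restrict_mem measurableSet_Ioc] with x hx
        refine (integral_kde_sub_sq_le_of_net hk hg hU hh x (f x)).trans ?_
        have := pow_le_pow_left₀ (abs_nonneg _) (hC x (Set.Ioc_subset_Icc_self hx)) 2
        rw [sq_abs] at this
        linarith
    _ ≤ 2 ^ (t + s) / (2 ^ m * h ^ 2) * (h * ∫ x, k x ^ 2) + (b - a) * (C ^ 2 * h ^ 4) := by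
        rw [integral_add hint (integrable_const _), integral_const_mul,
          ← intervalIntegral.integral_of_le hab, setIntegral_const,
          Real.volume_real_Ioc_of_le hab, smul_eq_mul]
        exact add_le_add_left (mul_le_mul_of_nonneg_left
          (intervalIntegral_kernelVariance_le hk hg hh hab) (by positivity)) _
    _ = 2 ^ (t + s) * (∫ x, k x ^ 2) / (2 ^ m * h) + (b - a) * (C ^ 2 * h ^ 4) := by
        field_simp
    _ ≤ _ := by
        gcongr
        exact two_pow_add_le t s

lemma mise_le_mise_monteCarlo {t m : ℕ} (hk : IsKernel k) (hg : Measurable g) {f : ℝ → ℝ}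
    (hf : Measurable f) {U : Ω → Fin (2 ^ m) → Fin s → ℝ} (hU : IsScrambledNet μ t m U)
    {Ω' : Type*} [MeasurableSpace Ω'] {μ' : Measure Ω'} [IsProbabilityMeasure μ']
    {V : Ω' → Fin (2 ^ m) → Fin s → ℝ} (hV : IsMonteCarlo μ' V) {h : ℝ} (hh : 0 < h)
    {a b B : ℝ} (hab : a ≤ b)
    (hB : ∀ x ∈ Set.Icc a b, |kernelMean g k h x / h - f x| ≤ B) :
    mise μ U g f k h a b ≤ 2 ^ t * 3 ^ s * mise μ' V g f k h a b := by
  rw [mise, mise, intervalIntegral.integral_of_le hab, intervalIntegral.integral_of_le hab,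
    ← integral_const_mul]
  have hMC := fun x => integral_kde_sub_sq_of_monteCarlo hk hg (by positivity) hV hh x (f x)
  simp only [hMC]
  refine integral_mono_of_nonneg (ae_of_all _ fun x => integral_nonneg fun _ => sq_nonneg _)
    (Integrable.const_mul (Integrable.add
      ((integrable_kernelVariance hk hg hh).const_mul _).integrableOn ?_) _)
    (ae_of_all _ fun x => ?_)
  · refine Measure.integrableOn_of_bounded (M := B ^ 2) (by simp)
      ((((measurable_kernelMean hk hg h).div_const h).sub hf).pow_const 2).aestronglyMeasurable ?_
    filter_upwards [ae_restrict_mem measurableSet_Ioc] with x hx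
    rw [norm_pow]
    exact pow_le_pow_left₀ (abs_nonneg _) (hB x (Set.Ioc_subset_Icc_self hx)) 2
  · refine (integral_kde_sub_sq_le_of_net hk hg hU hh x (f x)).trans ?_
    have hc := two_pow_add_le t s
    have h1 : (1 : ℝ) ≤ 2 ^ t * 3 ^ s :=
      one_le_mul_of_one_le_of_one_le (one_le_pow₀ (by norm_num)) (one_le_pow₀ (by norm_num))
    have hv := kernelVariance_nonneg (g := g) (k := k) h x
    push_cast
    rw [mul_add]
    refine add_le_add ?_ (le_mul_of_one_le_left (sq_nonneg _) h1)
    rw [← mul_assoc, mul_one_div]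
    gcongr

end Kernel

/-- Bounds for a positive sequence of exact order `n ^ (-1/5)`, valid for all `n ≥ 1`. -/
lemma exists_bandwidth_bounds {h : ℕ → ℝ} (hpos : ∀ n, 1 ≤ n → 0 < h n)
    (hΘ : h =Θ[atTop] fun n : ℕ => (n : ℝ) ^ (-(1 / 5) : ℝ)) :
    ∃ c₁ > 0, ∃ c₂ > 0, ∀ n : ℕ, 1 ≤ n →
      1 / (n * h n) ≤ c₁ * (n : ℝ) ^ (-(4 / 5) : ℝ) ∧ h n ^ 4 ≤ c₂ * (n : ℝ) ^ (-(4 / 5) : ℝ) := by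
  obtain ⟨c₁, hc₁, h1⟩ := bound_of_isBigO_nat_atTop hΘ.2
  obtain ⟨c₂, hc₂, h2⟩ := bound_of_isBigO_nat_atTop hΘ.1
  refine ⟨c₁, hc₁, c₂ ^ 4, by positivity, fun n hn => ?_⟩
  have hn0 : (0 : ℝ) < n := by exact_mod_cast hn
  have hw : 0 < (n : ℝ) ^ (-(1 / 5) : ℝ) := Real.rpow_pos_of_pos hn0 _
  have hhn := hpos n hn
  have h1' := h1 (x := n) hhn.ne'
  have h2' := h2 (x := n) hw.ne'
  rw [Real.norm_of_nonneg hw.le, Real.norm_of_nonneg hhn.le] at h1' h2'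
  have e4 : ((n : ℝ) ^ (-(1 / 5) : ℝ)) ^ 4 = (n : ℝ) ^ (-(4 / 5) : ℝ) := by
    rw [← Real.rpow_natCast, ← Real.rpow_mul hn0.le]
    norm_num
  have e5 : (n : ℝ) * (n : ℝ) ^ (-(4 / 5) : ℝ) * ((n : ℝ) ^ (-(1 / 5) : ℝ)) = 1 := by
    nth_rewrite 1 [← Real.rpow_one (n : ℝ)]
    rw [← Real.rpow_add hn0, ← Real.rpow_add hn0]
    norm_num
  constructor
  · rw [div_le_iff₀ (by positivity), ← e5]
    have hq : 0 ≤ (n : ℝ) * (n : ℝ) ^ (-(4 / 5) : ℝ) := by positivity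
    calc _ ≤ (n : ℝ) * (n : ℝ) ^ (-(4 / 5) : ℝ) * (c₁ * h n) := mul_le_mul_of_nonneg_left h1' hq
      _ = _ := by ring
  · rw [← e4, ← mul_pow]
    exact pow_le_pow_left₀ hhn.le h2' 4

end NestedScrambling

theorem proposition4p4 {s : ℕ} (g : (Fin s → ℝ) → ℝ) (hg : Measurable g)
    (f : ℝ → ℝ) (hf : IsDensityOf f g) (k : ℝ → ℝ) (hk : IsKernel k)
    (a b : ℝ) (hab : a < b) (T : ℕ) :
    -- first bound on the integrated variance
    (∃ C : ℝ, ∀ t m : ℕ, t ≤ T → ∀ h : ℝ, 0 < h → h ≤ 1 →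
      ∀ (Ω : Type*) [MeasurableSpace Ω] (μ : Measure Ω) [IsProbabilityMeasure μ]
        (U : Ω → Fin (2 ^ m) → Fin s → ℝ), IsScrambledNet μ t m U →
        integratedVariance μ U g k h a b
          ≤ 2 ^ t * 3 ^ s * (∫ x, k x ^ 2) / (2 ^ m * h) + C * (h / 2 ^ m)) ∧
    -- the integrated variance is `O(1/(nh))`
    (∃ K : ℝ, ∀ t m : ℕ, t ≤ T → ∀ h : ℝ, 0 < h → h ≤ 1 →
      ∀ (Ω : Type*) [MeasurableSpace Ω] (μ : Measure Ω) [IsProbabilityMeasure μ]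
        (U : Ω → Fin (2 ^ m) → Fin s → ℝ), IsScrambledNet μ t m U →
        integratedVariance μ U g k h a b ≤ K * (1 / (2 ^ m * h))) ∧
    (IsSmoothDensityOn f a b →
      -- for bandwidths of exact order `n^(-1/5)`, the MISE is `O(n^(-4/5))`
      (∀ h : ℕ → ℝ, (∀ n, 1 ≤ n → 0 < h n) →
        (h =Θ[atTop] fun n : ℕ => (n : ℝ) ^ (-(1 / 5) : ℝ)) →
        ∃ K : ℝ, ∀ t m : ℕ, t ≤ T →
          ∀ (Ω : Type*) [MeasurableSpace Ω] (μ : Measure Ω) [IsProbabilityMeasure μ]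
            (U : Ω → Fin (2 ^ m) → Fin s → ℝ), IsScrambledNet μ t m U →
            mise μ U g f k (h (2 ^ m)) a b ≤ K * ((2 : ℝ) ^ m) ^ (-(4 / 5) : ℝ)) ∧
      -- the MISE is never worse, up to the factor `2^t 3^s`, than with plain Monte Carlo
      (∀ t m : ℕ, t ≤ T → ∀ h : ℝ, 0 < h →
        ∀ (Ω : Type*) [MeasurableSpace Ω] (μ : Measure Ω) [IsProbabilityMeasure μ]
          (U : Ω → Fin (2 ^ m) → Fin s → ℝ), IsScrambledNet μ t m U →
        ∀ (Ω' : Type*) [MeasurableSpace Ω'] (μ' : Measure Ω') [IsProbabilityMeasure μ']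
          (V : Ω' → Fin (2 ^ m) → Fin s → ℝ), IsMonteCarlo μ' V →
          mise μ U g f k h a b ≤ 2 ^ t * 3 ^ s * mise μ' V g f k h a b)) := by
  have hk2 : 0 ≤ ∫ x, k x ^ 2 := integral_nonneg fun _ => sq_nonneg _
  refine ⟨⟨0, fun t m _ h hh _ Ω _ μ _ U hU => ?_⟩,
    ⟨2 ^ T * 3 ^ s * ∫ x, k x ^ 2, fun t m ht h hh _ Ω _ μ _ U hU => ?_⟩, fun hs => ?_⟩
  · simpa using NestedScrambling.integratedVariance_le hk hg hU hh hab.le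
  · refine (NestedScrambling.integratedVariance_le hk hg hU hh hab.le).trans ?_
    rw [mul_one_div]
    gcongr
    exact one_le_two
  · obtain ⟨C, hC⟩ := exists_bias_bound hg hf hk hs
    refine ⟨fun h hpos hΘ => ?_, fun t m _ h hh Ω _ μ _ U hU Ω' _ μ' _ V hV =>
      NestedScrambling.mise_le_mise_monteCarlo hk hg hf.meas hU hV hh hab.le (hC h hh)⟩
    obtain ⟨c₁, hc₁, c₂, hc₂, hbd⟩ := NestedScrambling.exists_bandwidth_bounds hpos hΘ
    refine ⟨2 ^ T * 3 ^ s * (∫ x, k x ^ 2) * c₁ + (b - a) * (C ^ 2 * c₂),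
      fun t m ht Ω _ μ _ U hU => ?_⟩
    have hh := hpos (2 ^ m) Nat.one_le_two_pow
    obtain ⟨h1, h2⟩ := hbd (2 ^ m) Nat.one_le_two_pow
    push_cast at h1 h2
    have hab' : 0 ≤ b - a := sub_nonneg.2 hab.le
    refine (NestedScrambling.mise_le hk hg hU hh hab.le (hC _ hh)).trans ?_
    calc _ = 2 ^ t * 3 ^ s * (∫ x, k x ^ 2) * (1 / (2 ^ m * h (2 ^ m)))
          + (b - a) * (C ^ 2 * h (2 ^ m) ^ 4) := by ring
      _ ≤ 2 ^ T * 3 ^ s * (∫ x, k x ^ 2) * (c₁ * ((2 : ℝ) ^ m) ^ (-(4 / 5) : ℝ))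
          + (b - a) * (C ^ 2 * (c₂ * ((2 : ℝ) ^ m) ^ (-(4 / 5) : ℝ))) := by
        gcongr
        exact one_le_two
      _ = _ := by ring
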